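/- For every real $\alpha>0$ there is $N(\alpha)\in\mathbb N$, depending only on $\alpha$, such that for every integer $n\ge N(\alpha)$ the following two statements hold. (1) For pairwise distinct $x_1,\dots,x_n\in[0,1)$ let $\Gamma=\bigcup_{k=1}^n(\mathbb Z+x_k)$ and $p_\alpha(x)=\sum_{\gamma\in\Gamma}e^{-\pi\alpha(x-\gamma)^2}$ for $x\in\mathbb R$. Then the minimum $\min_{x\in\mathbb R}p_\alpha(x)$ is attained, and a configuration $\Gamma$ maximizes it among all configurations of this form (with the same $n$) if and only if its points are equispaced, i.e. $\Gamma=z+\frac1n\mathbb Z$ for some $z\in\mathbb R$. (2) For $x$ in the torus $\mathbb T=\mathbb R/\mathbb Z$ let $\theta_\alpha(x)=\sum_{k\in\mathbb Z}e^{-\pi\alpha k^2}e^{2\pi i k x}$, which is real, and for pairwise distinct $x_1,\dots,x_n\in\mathbb T$ let $f_\alpha(x)=\sum_{j=1}^n\theta_\alpha(x-x_j)$. Then the minimum $\min_{x\in\mathbb T}f_\alpha(x)$ is attained, and a set $\{x_1,\dots,x_n\}$ of $n$ distinct points maximizes it among all sets of $n$ distinct points of $\mathbb T$ if and only if its points are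 equispaced, i.e. $\{x_1,\dots,x_n\}=\{z+\frac jn: 0\le j\le n-1\}$ in $\mathbb T$ for some $z\in\mathbb T$. -/

import Mathlib

/-- The points `x₁, …, xₙ` of one period: pairwise distinct and in `[0, 1)`. -/
def periodPoints (n : ℕ) : Set (Fin n → ℝ) :=
  {x | (∀ k, x k ∈ Set.Ico (0 : ℝ) 1) ∧ Function.Injective x}

/-- The 1-periodic configuration `Γ = ⋃ₖ (ℤ + xₖ)`. -/
def periodicConfig {n : ℕ} (x : Fin n → ℝ) : Set ℝ :=
  ⋃ k : Fin n, {y : ℝ | ∃ m : ℤ, y = (m : ℝ) + x k}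

/-- `p_α(t) = ∑_{γ ∈ Γ} exp (-π α (t - γ)²)` for a set `Γ` of real numbers. -/
noncomputable def gaussianPotential (α : ℝ) (Γ : Set ℝ) (t : ℝ) : ℝ :=
  ∑' γ : Γ, Real.exp (-Real.pi * α * (t - (γ : ℝ)) ^ 2)

/-- `Γ` is a translate of `(1/n) ℤ`. -/
def IsEquispacedLine (n : ℕ) (Γ : Set ℝ) : Prop :=
  ∃ z : ℝ, Γ = Set.range (fun j : ℤ => z + (j : ℝ) / (n : ℝ))

/-- The `n`-tuples of pairwise distinct points on the torus `ℝ / ℤ`. -/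
def torusPoints (n : ℕ) : Set (Fin n → UnitAddCircle) :=
  {x | Function.Injective x}

/-- `θ_α(t) = ∑_{k ∈ ℤ} exp (-π α k²) exp (2 π i k t)` on the torus `ℝ / ℤ`. The sum is real
(see `ofReal_torusTheta`), so that passing to the real part only changes the type. -/
noncomputable def torusTheta (α : ℝ) (t : UnitAddCircle) : ℝ :=
  (∑' k : ℤ, (Real.exp (-Real.pi * α * (k : ℝ) ^ 2) : ℂ) * fourier k t).re

theorem ofReal_torusTheta (α : ℝ) (t : UnitAddCircle) :
    (torusTheta α t : ℂ) =
      ∑' k : ℤ, (Real.exp (-Real.pi * α * (k : ℝ) ^ 2) : ℂ) * fourier k t := by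
  unfold torusTheta
  rw [← Complex.conj_eq_iff_re, Complex.conj_tsum, ← (Equiv.neg ℤ).tsum_eq]
  refine tsum_congr fun k => ?_
  rw [map_mul, Complex.conj_ofReal, ← fourier_neg]
  simp

/-- `f_α(t) = ∑ⱼ θ_α(t - xⱼ)`. -/
noncomputable def thetaSum (α : ℝ) {n : ℕ} (x : Fin n → UnitAddCircle) (t : UnitAddCircle) : ℝ :=
  ∑ j : Fin n, torusTheta α (t - x j)

/-- The points are, as a set, a translate of `{0, 1/n, …, (n-1)/n}` on the torus. -/
def IsEquispacedTorus {n : ℕ} (x : Fin n → UnitAddCircle) : Prop :=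
  ∃ z : UnitAddCircle,
    Set.range x = Set.range (fun j : Fin n => z + (((j : ℝ) / (n : ℝ) : ℝ) : UnitAddCircle))

/-! Poisson summation turns the line potential for `α` into a positive constant times the torus
potential for `1/α`, so everything rests on the torus. With points `w_j` on the unit circle, the
potential is `F(S) = ∑ g_k p_k S^(-k)`, where `g_k = exp (-π α k²)` and `p_k` is the `k`-th power
sum. Let `M` be its minimum for equispaced points, `q = g_n` and `s = √q`. The claim is rigidity: if
`F ≥ M` everywhere, then the elementary symmetric functions `e_k`, `0 < k < n`, vanish. The `w_j`
are then the roots of `X^n - c`, hence equispaced.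

The engine is `norm_aliasSum_le`: on any uniform grid `F - M ≥ 0`, so each nonconstant discrete
Fourier coefficient is at most the mean of `F - M`. It is used twice.

Coarse bound: on `2n` nodes the mean excess is `O(nq)`, while `g_k ≥ s` for `k ≤ n/2`. Hence `p_k`,
and by Newton's identities `e_k`, is `O(ns)`. The reflection `e_(n-k) = e_n * conj e_k` covers the
other indices.

Bootstrap: let `E = max |e_k|`. Each `w_j^n` lies within `nE` of `c = -(-1)^n e_n`. On the `n` nodes
with `T^n = -c`, close to the local minima, the mean excess is quadratic in `E` because `-1`
minimizes the theta series. The coefficient of frequency `k` is linear in `e_k`: the frequencies `k`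
and `k - n` reinforce each other there (`norm_elemSymm_le_norm_add`). So `E ≤ 12 n³ E² + 24 n² E s`,
and with `E = O(ns)` this forces `E = 0` once `n⁴ s` is small. -/

/-! ### Gaussian weights and geometric tail bounds. -/

/-- The Gaussian weight `exp (-π α k²)` of the frequency `k`. -/
noncomputable def gaussWeight (α : ℝ) (k : ℤ) : ℝ := Real.exp (-Real.pi * α * (k : ℝ) ^ 2)

/-- The theta series `∑ₖ exp (-π α k²) uᵏ` as a function of `u`, used for `‖u‖ = 1`. -/
noncomputable def thetaSeries (α : ℝ) (u : ℂ) : ℂ := ∑' k : ℤ, (gaussWeight α k : ℂ) * u ^ k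

lemma hasSum_geometric_natAbs {r : ℝ} (h0 : 0 ≤ r) (h1 : r < 1) :
    HasSum (fun m : ℤ => if m = 0 then 0 else r ^ m.natAbs) (r * (1 - r)⁻¹ + r * (1 - r)⁻¹) := by
  have h := (hasSum_geometric_of_lt_one h0 h1).mul_left r
  have h' := HasSum.of_add_one_of_neg_add_one
    (f := fun m : ℤ => if m = 0 then 0 else r ^ m.natAbs) (m := r * (1 - r)⁻¹)
    (m' := r * (1 - r)⁻¹) ?_ ?_
  · simpa using h'
  all_goals
    refine (iff_of_eq (congrArg (HasSum · _) (funext fun k => ?_))).2 h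
    have h1 : (k : ℤ) + 1 ≠ 0 := by omega
    have h2 : -((k : ℤ) + 1) ≠ 0 := by omega
    have h3 : ((k : ℤ) + 1).natAbs = k + 1 := by omega
    have h4 : (-((k : ℤ) + 1)).natAbs = k + 1 := by omega
    simp only [h1, h2, h3, h4, if_false, pow_succ']

/-- The common tail estimate: main terms are subtracted first, and what is left decays geometrically
in `|m|`. Both halves of `ℤ` give `r / (1 - r) ≤ 2r`. -/
lemma norm_tsum_le_of_geometric {E : Type*} [NormedAddCommGroup E] [CompleteSpace E]
    {a : ℤ → E} {C r : ℝ} (hr0 : 0 ≤ r) (hr : r ≤ 1 / 2) (hC : 0 ≤ C) (h0 : a 0 = 0)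
    (h : ∀ m : ℤ, m ≠ 0 → ‖a m‖ ≤ C * r ^ m.natAbs) :
    Summable a ∧ ‖∑' m, a m‖ ≤ 4 * C * r := by
  have hs := (hasSum_geometric_natAbs hr0 (by linarith)).mul_left C
  have hb : ∀ m : ℤ, ‖a m‖ ≤ C * (if m = 0 then 0 else r ^ m.natAbs) := by
    intro m
    by_cases hm : m = 0
    · simp [hm, h0]
    · simpa [hm] using h m hm
  refine ⟨Summable.of_norm_bounded hs.summable hb, (tsum_of_norm_bounded hs hb).trans ?_⟩
  have : (1 - r)⁻¹ ≤ 2 := by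
    rw [inv_le_comm₀ (by linarith) (by norm_num)]
    linarith
  have h2 : r * (1 - r)⁻¹ ≤ r * 2 := by gcongr
  nlinarith

lemma gaussWeight_pos (α : ℝ) (k : ℤ) : 0 < gaussWeight α k := Real.exp_pos _

lemma gaussWeight_zero (α : ℝ) : gaussWeight α 0 = 1 := by simp [gaussWeight]

lemma gaussWeight_neg (α : ℝ) (k : ℤ) : gaussWeight α (-k) = gaussWeight α k := by
  simp [gaussWeight]

lemma gaussWeight_mul (α : ℝ) (k l : ℤ) :
    gaussWeight α (k * l) = gaussWeight (α * (l : ℝ) ^ 2) k := by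
  simp only [gaussWeight]
  push_cast
  ring_nf

/-- `exp (-π α k²) ≤ exp (-π α l²) exp (-π α n²)ʲ` whenever `l² + j n² ≤ k²`. -/
lemma gaussWeight_le_mul_pow {α : ℝ} (hα : 0 < α) {k l n : ℤ} {j : ℕ}
    (h : l ^ 2 + j * n ^ 2 ≤ k ^ 2) :
    gaussWeight α k ≤ gaussWeight α l * gaussWeight α n ^ j := by
  unfold gaussWeight
  rw [← Real.exp_nat_mul, ← Real.exp_add, Real.exp_le_exp]
  have h' : (l : ℝ) ^ 2 + j * (n : ℝ) ^ 2 ≤ (k : ℝ) ^ 2 := by exact_mod_cast h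
  nlinarith [mul_le_mul_of_nonneg_left h' (mul_pos Real.pi_pos hα).le]

lemma gaussWeight_le {α : ℝ} (hα : 0 < α) {k l : ℤ} (h : l ^ 2 ≤ k ^ 2) :
    gaussWeight α k ≤ gaussWeight α l := by
  simpa using gaussWeight_le_mul_pow hα (k := k) (l := l) (n := 0) (j := 0) (by simpa using h)

lemma gaussWeight_le_pow {α : ℝ} (hα : 0 < α) {k n : ℤ} {j : ℕ}
    (h : j * n ^ 2 ≤ k ^ 2) : gaussWeight α k ≤ gaussWeight α n ^ j := by
  simpa [gaussWeight_zero] using gaussWeight_le_mul_pow hα (l := 0) (j := j) (by simpa using h)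

lemma natAbs_le_sq (m : ℤ) : (m.natAbs : ℤ) ≤ m ^ 2 := by
  rw [← Int.natAbs_sq]
  exact_mod_cast Nat.le_self_pow two_ne_zero _

lemma summable_gaussWeight {α : ℝ} (hα : 0 < α) : Summable (gaussWeight α) := by
  have hr : gaussWeight α 1 < 1 := by
    unfold gaussWeight
    rw [Real.exp_lt_one_iff]
    have := mul_pos Real.pi_pos hα
    push_cast
    nlinarith
  have h := (hasSum_geometric_natAbs (gaussWeight_pos α 1).le hr).summable
  have h1 : Summable fun m : ℤ => if m = 0 then (1 : ℝ) else 0 :=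
    (hasSum_ite_eq (0 : ℤ) (1 : ℝ)).summable
  refine Summable.of_nonneg_of_le (fun k => (gaussWeight_pos α k).le) (fun k => ?_) (h.add h1)
  by_cases hk : k = 0
  · simp [hk, gaussWeight_zero]
  · simpa [hk] using gaussWeight_le_pow hα (k := k) (n := 1) (j := k.natAbs)
      (by simpa using natAbs_le_sq k)

lemma summable_gaussWeight_mul {α : ℝ} (hα : 0 < α) {v : ℤ → ℂ} (hv : ∀ k, ‖v k‖ ≤ 1) :
    Summable fun k : ℤ => (gaussWeight α k : ℂ) * v k := by
  refine Summable.of_norm_bounded (summable_gaussWeight hα) fun k => ?_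
  rw [norm_mul, Complex.norm_real, Real.norm_of_nonneg (gaussWeight_pos α k).le]
  exact mul_le_of_le_one_right (gaussWeight_pos α k).le (hv k)

lemma norm_zpow_of_norm_one {u : ℂ} (hu : ‖u‖ = 1) (k : ℤ) : ‖u ^ k‖ = 1 := by
  rw [norm_zpow, hu, one_zpow]

lemma ne_zero_of_norm_one {u : ℂ} (hu : ‖u‖ = 1) : u ≠ 0 := by
  rintro rfl
  simp at hu

/-! ### Averages over roots of unity. -/

lemma IsPrimitiveRoot.sum_zpow {L : ℕ} {ζ : ℂ} (hζ : IsPrimitiveRoot ζ L) (i : ℤ) :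
    ∑ l ∈ Finset.range L, (ζ ^ l) ^ i = if (L : ℤ) ∣ i then (L : ℂ) else 0 := by
  have hcomm : ∀ l : ℕ, (ζ ^ l) ^ i = (ζ ^ i) ^ l := fun l => by
    rw [← zpow_natCast, ← zpow_natCast, ← zpow_mul, ← zpow_mul, mul_comm]
  simp only [hcomm]
  split_ifs with h
  · rw [(hζ.zpow_eq_one_iff_dvd i).2 h]
    simp
  · have h1 : ζ ^ i ≠ 1 := fun h' => h ((hζ.zpow_eq_one_iff_dvd i).1 h')
    have h2 := mul_geom_sum (ζ ^ i) L
    rw [← hcomm, hζ.pow_eq_one, one_zpow, sub_self] at h2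
    exact (mul_eq_zero.1 h2).resolve_left (sub_ne_zero.2 h1)

/-- Averaging a theta series against a character over a coset of the `L`-th roots of unity only
keeps the frequencies of one residue class modulo `L`. -/
lemma sum_zpow_mul_thetaSeries {α : ℝ} (hα : 0 < α) {L : ℕ} (hL : 0 < L) {ζ : ℂ}
    (hζ : IsPrimitiveRoot ζ L) {T w : ℂ} (hT : ‖T‖ = 1) (hw : ‖w‖ = 1) (k : ℤ) :
    ∑ l ∈ Finset.range L, (T * ζ ^ l) ^ k * thetaSeries α (w / (T * ζ ^ l)) =
      L * ∑' m : ℤ, (gaussWeight α (k + m * L) : ℂ) * (T ^ (-(m * L)) * w ^ (k + m * L)) := by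
  have hζ1 : ‖ζ‖ = 1 := hζ.norm'_eq_one hL.ne'
  have hT0 := ne_zero_of_norm_one hT
  have hζ0 := ne_zero_of_norm_one hζ1
  have hterm : ∀ l : ℕ, (T * ζ ^ l) ^ k * thetaSeries α (w / (T * ζ ^ l)) =
      ∑' i : ℤ, (gaussWeight α i : ℂ) * (w ^ i * T ^ (k - i) * (ζ ^ l) ^ (k - i)) := by
    intro l
    rw [thetaSeries, ← tsum_mul_left]
    refine tsum_congr fun i => ?_
    have hl : ζ ^ l ≠ 0 := pow_ne_zero _ hζ0
    rw [div_zpow, mul_zpow, mul_zpow, zpow_sub₀ hT0, zpow_sub₀ hl]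
    field_simp
  simp only [hterm]
  rw [← Summable.tsum_finsetSum]
  swap
  · intro l _
    refine summable_gaussWeight_mul hα fun i => ?_
    rw [norm_mul, norm_mul, norm_zpow_of_norm_one hw, norm_zpow_of_norm_one hT,
      norm_zpow_of_norm_one (by rw [norm_pow, hζ1, one_pow])]
    norm_num
  have hsum : ∀ i : ℤ, ∑ l ∈ Finset.range L,
      (gaussWeight α i : ℂ) * (w ^ i * T ^ (k - i) * (ζ ^ l) ^ (k - i)) =
      (gaussWeight α i : ℂ) * (w ^ i * T ^ (k - i) * if (L : ℤ) ∣ k - i then (L : ℂ) else 0) := by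
    intro i
    rw [← Finset.mul_sum, ← Finset.mul_sum, hζ.sum_zpow]
  simp only [hsum]
  have hinj : Function.Injective fun m : ℤ => k + m * (L : ℤ) := by
    intro a b hab
    simpa [hL.ne'] using hab
  -- Orthogonality leaves only the `i` congruent to `k` modulo `L`, so the sum may be reindexed by
  -- `i = k + m L`.
  rw [← hinj.tsum_eq, ← tsum_mul_left]
  · refine tsum_congr fun m => ?_
    have : (L : ℤ) ∣ k - (k + m * L) := ⟨-m, by ring⟩
    rw [if_pos this]
    have : k - (k + m * L) = -(m * L) := by ring
    rw [this]
    ring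
  · intro i hi
    by_cases hd : (L : ℤ) ∣ k - i
    · obtain ⟨m, hm⟩ := hd
      exact ⟨-m, by simp only; linarith⟩
    · simp [hd] at hi

/-! ### Elementary facts on the unit circle. -/

lemma conj_eq_inv_of_norm_one {u : ℂ} (hu : ‖u‖ = 1) : (starRingEnd ℂ) u = u⁻¹ := by
  rw [Complex.inv_eq_conj hu]

lemma conj_thetaSeries {α : ℝ} {u : ℂ} (hu : ‖u‖ = 1) :
    (starRingEnd ℂ) (thetaSeries α u) = thetaSeries α u := by
  rw [thetaSeries, Complex.conj_tsum, ← (Equiv.neg ℤ).tsum_eq]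
  refine tsum_congr fun k => ?_
  rw [map_mul, Complex.conj_ofReal, Equiv.neg_apply, gaussWeight_neg, map_zpow₀,
    conj_eq_inv_of_norm_one hu, inv_zpow, zpow_neg, inv_inv]

lemma ofReal_re_thetaSeries {α : ℝ} {u : ℂ} (hu : ‖u‖ = 1) :
    ((thetaSeries α u).re : ℂ) = thetaSeries α u :=
  Complex.conj_eq_iff_re.1 (conj_thetaSeries hu)

lemma norm_pow_sub_one_le {u : ℂ} (hu : ‖u‖ = 1) (m : ℕ) : ‖u ^ m - 1‖ ≤ m * ‖u - 1‖ := by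
  rw [← mul_geom_sum, norm_mul, mul_comm]
  gcongr
  refine (norm_sum_le _ _).trans ?_
  simp [hu]

lemma norm_zpow_sub_one_le {u : ℂ} (hu : ‖u‖ = 1) (m : ℤ) :
    ‖u ^ m - 1‖ ≤ m.natAbs * ‖u - 1‖ := by
  rcases Int.natAbs_eq m with h | h
  · conv_lhs => rw [h, zpow_natCast]
    exact norm_pow_sub_one_le hu _
  · conv_lhs => rw [h, zpow_neg, zpow_natCast, ← inv_pow]
    refine (norm_pow_sub_one_le (by rw [norm_inv, hu, inv_one]) _).trans_eq ?_
    have : u⁻¹ - 1 = -(u⁻¹ * (u - 1)) := by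
      field_simp [ne_zero_of_norm_one hu]
      ring
    rw [this, norm_neg, norm_mul, norm_inv, hu, inv_one, one_mul]

lemma re_sub_one_of_norm_one {u : ℂ} (hu : ‖u‖ = 1) : u.re - 1 = -‖u - 1‖ ^ 2 / 2 := by
  have h : u.re * u.re + u.im * u.im = 1 := by
    rw [← Complex.normSq_apply, Complex.normSq_eq_norm_sq, hu, one_pow]
  rw [← Complex.normSq_eq_norm_sq, Complex.normSq_apply]
  simp
  nlinarith

/-! ### Power sums and elementary symmetric functions of points on the circle. -/

/-- The power sum `∑ⱼ wⱼᵏ` for an integer exponent. -/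
noncomputable def powSum {n : ℕ} (w : Fin n → ℂ) (k : ℤ) : ℂ := ∑ j, w j ^ k

/-- The elementary symmetric polynomial of degree `k` evaluated at `w`. -/
noncomputable def elemSymm {n : ℕ} (w : Fin n → ℂ) (k : ℕ) : ℂ :=
  MvPolynomial.aeval w (MvPolynomial.esymm (Fin n) ℂ k)

section SymmetricFunctions

variable {n : ℕ} {w : Fin n → ℂ}

lemma elemSymm_eq_sum (w : Fin n → ℂ) (k : ℕ) :
    elemSymm w k = ∑ s ∈ Finset.powersetCard k Finset.univ, ∏ i ∈ s, w i := by
  simp [elemSymm, MvPolynomial.esymm, map_sum, map_prod]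

lemma aeval_psum (w : Fin n → ℂ) (k : ℕ) :
    MvPolynomial.aeval w (MvPolynomial.psum (Fin n) ℂ k) = powSum w k := by
  simp [powSum, MvPolynomial.psum]

lemma elemSymm_zero (w : Fin n → ℂ) : elemSymm w 0 = 1 := by
  simp [elemSymm]

lemma elemSymm_card (w : Fin n → ℂ) : elemSymm w n = ∏ i, w i := by
  have : Finset.powersetCard n (Finset.univ : Finset (Fin n)) = {Finset.univ} := by
    simpa using Finset.powersetCard_self (Finset.univ : Finset (Fin n))
  rw [elemSymm_eq_sum, this, Finset.sum_singleton]

lemma norm_elemSymm_card (hw : ∀ j, ‖w j‖ = 1) : ‖elemSymm w n‖ = 1 := by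
  simp [elemSymm_card, norm_prod, hw]

/-- On the circle conjugation is inversion, so the product over a complement is the full product
times the conjugate of the product over the set. -/
lemma elemSymm_card_sub (hw : ∀ j, ‖w j‖ = 1) {k : ℕ} (hk : k ≤ n) :
    elemSymm w (n - k) = elemSymm w n * (starRingEnd ℂ) (elemSymm w k) := by
  rw [elemSymm_eq_sum w k, elemSymm_eq_sum w (n - k), map_sum, Finset.mul_sum]
  refine Finset.sum_nbij' (fun s => sᶜ) (fun s => sᶜ) ?_ ?_ ?_ ?_ ?_
  · intro s hs
    rw [Finset.mem_powersetCard_univ] at hs ⊢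
    rw [Finset.card_compl, hs, Fintype.card_fin]
    omega
  · intro s hs
    rw [Finset.mem_powersetCard_univ] at hs ⊢
    rw [Finset.card_compl, hs, Fintype.card_fin]
  · simp
  · simp
  · intro s _
    rw [elemSymm_card, map_prod, ← Finset.prod_mul_prod_compl s w, mul_assoc,
      ← Finset.prod_mul_distrib]
    refine (mul_one _).symm.trans (congrArg _ (Finset.prod_eq_one fun i _ => ?_).symm)
    rw [conj_eq_inv_of_norm_one (hw i), mul_inv_cancel₀ (ne_zero_of_norm_one (hw i))]

lemma mul_elemSymm_eq_sum (w : Fin n → ℂ) (k : ℕ) :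
    k * elemSymm w k = (-1) ^ (k + 1) *
      ∑ i ∈ Finset.range k, (-1) ^ i * elemSymm w i * powSum w ((k - i : ℕ) : ℤ) := by
  have h := congrArg (MvPolynomial.aeval w) (MvPolynomial.mul_esymm_eq_sum (Fin n) ℂ k)
  simp only [map_mul, map_natCast, map_pow, map_neg, map_one, map_sum, aeval_psum] at h
  rw [elemSymm, h]
  congr 1
  rw [Finset.sum_filter, Finset.Nat.sum_antidiagonal_eq_sum_range_succ_mk, Finset.sum_range_succ]
  simp only [lt_irrefl, if_false, add_zero]
  exact Finset.sum_congr rfl fun i hi => by rw [if_pos (Finset.mem_range.1 hi)]; rfl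

lemma powSum_eq_sub_sum (w : Fin n → ℂ) {k : ℕ} (hk : 0 < k) :
    powSum w k = (-1) ^ (k + 1) * (k * elemSymm w k) -
      ∑ i ∈ Finset.Ioo 0 k, (-1) ^ i * elemSymm w i * powSum w ((k - i : ℕ) : ℤ) := by
  have h := mul_elemSymm_eq_sum w k
  have hr : Finset.range k = insert 0 (Finset.Ioo 0 k) := by
    ext i
    simp only [Finset.mem_range, Finset.mem_insert, Finset.mem_Ioo]
    omega
  rw [hr, Finset.sum_insert (by simp), elemSymm_zero] at h
  rw [h, ← mul_assoc, ← pow_add, Even.neg_one_pow ⟨_, rfl⟩]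
  simp

/-- Evaluate `∏ (X - w_i)` at its root `w_j` and isolate the leading and constant terms. -/
lemma pow_card_eq_sum (w : Fin n → ℂ) (hn : 0 < n) (j : Fin n) :
    w j ^ n - -(-1) ^ n * elemSymm w n =
      -∑ i ∈ Finset.Ioo 0 n, (-1) ^ i * elemSymm w i * w j ^ (n - i) := by
  have h := congrArg (Polynomial.eval (w j))
    (Multiset.prod_X_sub_X_eq_sum_esymm (Finset.univ.val.map w))
  have h0 : Polynomial.eval (w j) ((Finset.univ.val.map w).map
      fun t => Polynomial.X - Polynomial.C t).prod = 0 := by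
    rw [Multiset.map_map]
    change Polynomial.eval (w j) (∏ i, (Polynomial.X - Polynomial.C (w i))) = 0
    rw [Polynomial.eval_prod]
    exact Finset.prod_eq_zero (Finset.mem_univ j) (by simp)
  rw [h0, Polynomial.eval_finsetSum] at h
  have he : ∀ k, (Finset.univ.val.map w).esymm k = elemSymm w k := fun k =>
    (MvPolynomial.aeval_esymm_eq_multiset_esymm (Fin n) ℂ k w).symm
  simp only [Multiset.card_map, Finset.card_val, Finset.card_univ, Fintype.card_fin, he] at h
  have hr : Finset.range (n + 1) = insert 0 (insert n (Finset.Ioo 0 n)) := by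
    ext i
    simp only [Finset.mem_range, Finset.mem_insert, Finset.mem_Ioo]
    omega
  rw [hr, Finset.sum_insert (by simp; omega), Finset.sum_insert (by simp)] at h
  simp only [Polynomial.eval_mul, Polynomial.eval_pow, Polynomial.eval_neg, Polynomial.eval_one,
    Polynomial.eval_C, Polynomial.eval_X, pow_zero, Nat.sub_zero, Nat.sub_self, one_mul,
    mul_one] at h
  rw [elemSymm_zero] at h
  simp only [mul_assoc]
  linear_combination -h

lemma norm_powSum_le (hw : ∀ j, ‖w j‖ = 1) (k : ℤ) : ‖powSum w k‖ ≤ n := by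
  refine (norm_sum_le _ _).trans ?_
  simp [hw]

/-- Newton's identity writes `k e_k` as a sum of `k` terms. Since `P ≤ 1`, induction bounds each
earlier `e_i` by `1`, hence each term by `P`, and the factor `k` cancels. -/
lemma norm_elemSymm_le_of_powSum {P : ℝ} (hP : P ≤ 1) {K : ℕ}
    (h : ∀ k : ℕ, 0 < k → k ≤ K → ‖powSum w k‖ ≤ P) :
    ∀ k : ℕ, 0 < k → k ≤ K → ‖elemSymm w k‖ ≤ P := by
  intro k
  induction k using Nat.strong_induction_on with
  | _ k ih =>
    intro hk hkK
    have hle : ∀ i ∈ Finset.range k,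
        ‖(-1) ^ i * elemSymm w i * powSum w ((k - i : ℕ) : ℤ)‖ ≤ P := by
      intro i hi
      rw [Finset.mem_range] at hi
      have h1 : ‖elemSymm w i‖ ≤ 1 := by
        rcases Nat.eq_zero_or_pos i with rfl | hi0
        · simp [elemSymm_zero]
        · exact (ih i hi hi0 (by omega)).trans hP
      have h2 := h (k - i) (by omega) (by omega)
      rw [norm_mul, norm_mul, norm_pow, norm_neg, norm_one, one_pow, one_mul]
      exact (mul_le_of_le_one_left (norm_nonneg _) h1).trans h2
    have h3 := norm_sum_le_of_le _ hle
    have h4 := congrArg norm (mul_elemSymm_eq_sum w k)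
    rw [norm_mul, norm_mul, norm_pow, norm_neg, norm_one, one_pow, one_mul, Complex.norm_natCast]
      at h4
    rw [← h4, Finset.sum_const, Finset.card_range, nsmul_eq_mul] at h3
    exact le_of_mul_le_mul_left h3 (by exact_mod_cast hk)

variable {E : ℝ}

/-- The Newton terms besides `k e_k` are products `e_i p_(k-i)` with both indices strictly between
`0` and `n`. The free bound `B` allows two passes: `B = n` gives a linear bound on `p_k`, and
feeding that back makes the error quadratic in `E`. -/
lemma norm_powSum_sub_le_of_elemSymm {k : ℕ} (hk : 0 < k) (hkn : k < n)
    {B : ℝ} (hB : ∀ i : ℕ, 0 < i → i < n → ‖powSum w i‖ ≤ B) (hB0 : 0 ≤ B) (hE0 : 0 ≤ E)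
    (hE : ∀ i : ℕ, 0 < i → i < n → ‖elemSymm w i‖ ≤ E) :
    ‖powSum w k - (-1) ^ (k + 1) * (k * elemSymm w k)‖ ≤ n * (E * B) := by
  rw [powSum_eq_sub_sum w hk, sub_sub_cancel_left, norm_neg]
  have hle : ∀ i ∈ Finset.Ioo 0 k,
      ‖(-1) ^ i * elemSymm w i * powSum w ((k - i : ℕ) : ℤ)‖ ≤ E * B := by
    intro i hi
    rw [Finset.mem_Ioo] at hi
    rw [norm_mul, norm_mul, norm_pow, norm_neg, norm_one, one_pow, one_mul]
    exact mul_le_mul (hE i hi.1 (by omega)) (hB _ (by omega) (by omega)) (norm_nonneg _) hE0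
  refine (norm_sum_le_of_le _ hle).trans ?_
  rw [Finset.sum_const, nsmul_eq_mul, Nat.card_Ioo]
  have : ((k - 0 - 1 : ℕ) : ℝ) ≤ n := by exact_mod_cast (by omega)
  gcongr

lemma norm_powSum_le_of_elemSymm (hw : ∀ j, ‖w j‖ = 1) (hE0 : 0 ≤ E)
    (hE : ∀ i : ℕ, 0 < i → i < n → ‖elemSymm w i‖ ≤ E) {k : ℕ} (hk : 0 < k) (hkn : k < n) :
    ‖powSum w k‖ ≤ 2 * n ^ 2 * E := by
  have h1 := norm_powSum_sub_le_of_elemSymm hk hkn (fun i _ _ => norm_powSum_le hw i)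
    (Nat.cast_nonneg n) hE0 hE
  have h2 : ‖(-1) ^ (k + 1) * (k * elemSymm w k)‖ ≤ n * E := by
    rw [norm_mul, norm_mul, norm_pow, norm_neg, norm_one, one_pow, one_mul, Complex.norm_natCast]
    have : (k : ℝ) ≤ n := by exact_mod_cast hkn.le
    exact mul_le_mul this (hE k hk hkn) (norm_nonneg _) (Nat.cast_nonneg n)
  have h3 := norm_le_norm_add_norm_sub' (powSum w k) ((-1) ^ (k + 1) * (k * elemSymm w k))
  have hn : (1 : ℝ) ≤ n := by exact_mod_cast (by omega : 1 ≤ n)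
  nlinarith [mul_nonneg (mul_nonneg (sub_nonneg.2 hn) (Nat.cast_nonneg n : (0 : ℝ) ≤ n)) hE0]

lemma norm_powSum_sub_le (hw : ∀ j, ‖w j‖ = 1) (hE0 : 0 ≤ E)
    (hE : ∀ i : ℕ, 0 < i → i < n → ‖elemSymm w i‖ ≤ E) {k : ℕ} (hk : 0 < k) (hkn : k < n) :
    ‖powSum w k - (-1) ^ (k + 1) * (k * elemSymm w k)‖ ≤ 2 * n ^ 3 * E ^ 2 := by
  refine (norm_powSum_sub_le_of_elemSymm hk hkn
    (fun i h0 h1 => norm_powSum_le_of_elemSymm hw hE0 hE h0 h1) (by positivity) hE0 hE).trans_eq ?_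
  ring

lemma norm_pow_card_sub_le (hw : ∀ j, ‖w j‖ = 1) (hn : 0 < n) (hE0 : 0 ≤ E)
    (hE : ∀ i : ℕ, 0 < i → i < n → ‖elemSymm w i‖ ≤ E) (j : Fin n) :
    ‖w j ^ n - -(-1) ^ n * elemSymm w n‖ ≤ n * E := by
  rw [pow_card_eq_sum w hn j, norm_neg]
  have hle : ∀ i ∈ Finset.Ioo 0 n, ‖(-1) ^ i * elemSymm w i * w j ^ (n - i)‖ ≤ E := by
    intro i hi
    rw [Finset.mem_Ioo] at hi
    rw [norm_mul, norm_mul, norm_pow, norm_neg, norm_one, one_pow, one_mul, norm_pow, hw, one_pow,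
      mul_one]
    exact hE i hi.1 hi.2
  refine (norm_sum_le_of_le _ hle).trans ?_
  rw [Finset.sum_const, nsmul_eq_mul, Nat.card_Ioo]
  have : ((n - 0 - 1 : ℕ) : ℝ) ≤ n := by exact_mod_cast (by omega)
  gcongr

/-- Shifting the frequency by `m n` multiplies each term by `(w_j^n)^m`, which differs from `c^m` by
at most `|m| n E`. Up to this error the power sum is a rotation of `p_k`. -/
lemma norm_powSum_add_mul_le (hw : ∀ j, ‖w j‖ = 1) (hE0 : 0 ≤ E)
    (hE : ∀ i : ℕ, 0 < i → i < n → ‖elemSymm w i‖ ≤ E) {k : ℕ} (hk : 0 < k) (hkn : k < n) (m : ℤ) :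
    ‖powSum w (k + m * n)‖ ≤ (2 + m.natAbs) * n ^ 2 * E := by
  set c : ℂ := -(-1) ^ n * elemSymm w n with hc
  have hc1 : ‖c‖ = 1 := by simp [hc, norm_elemSymm_card hw]
  have hc0 := ne_zero_of_norm_one hc1
  have hdec : powSum w (k + m * n) =
      c ^ m * powSum w k + ∑ j, w j ^ (k : ℤ) * c ^ m * ((w j ^ n / c) ^ m - 1) := by
    rw [powSum, powSum, Finset.mul_sum, ← Finset.sum_add_distrib]
    refine Finset.sum_congr rfl fun j _ => ?_
    have hw0 := ne_zero_of_norm_one (hw j)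
    have hcm : c ^ m ≠ 0 := zpow_ne_zero _ hc0
    rw [div_zpow, zpow_add₀ hw0, mul_comm m, zpow_mul, zpow_natCast (w j) n]
    field_simp
    ring
  rw [hdec]
  have h1 : ‖c ^ m * powSum w k‖ ≤ 2 * n ^ 2 * E := by
    rw [norm_mul, norm_zpow_of_norm_one hc1, one_mul]
    exact norm_powSum_le_of_elemSymm hw hE0 hE hk hkn
  have h2 : ∀ j ∈ (Finset.univ : Finset (Fin n)),
      ‖w j ^ (k : ℤ) * c ^ m * ((w j ^ n / c) ^ m - 1)‖ ≤ m.natAbs * (n * E) := by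
    intro j _
    rw [norm_mul, norm_mul, norm_zpow_of_norm_one (hw j), norm_zpow_of_norm_one hc1, one_mul,
      one_mul]
    refine (norm_zpow_sub_one_le (by simp [hw j, hc1]) m).trans ?_
    gcongr
    rw [div_sub_one hc0, norm_div, hc1, div_one]
    exact norm_pow_card_sub_le hw (by omega) hE0 hE j
  have h3 := norm_sum_le_of_le _ h2
  rw [Finset.sum_const, Finset.card_univ, Fintype.card_fin, nsmul_eq_mul] at h3
  calc _ ≤ _ := norm_add_le _ _
    _ ≤ 2 * n ^ 2 * E + n * (m.natAbs * (n * E)) := add_le_add h1 h3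
    _ = _ := by ring

end SymmetricFunctions

/-! ### The theta series near its minimum at `-1`. -/

section ThetaBounds

variable {α : ℝ}

lemma norm_thetaSeries_sub_one_le (hα : 0 < α) (hq : gaussWeight α 1 ≤ 1 / 2) {u : ℂ}
    (hu : ‖u‖ = 1) : ‖thetaSeries α u - 1‖ ≤ 4 * gaussWeight α 1 := by
  have hs : Summable fun k : ℤ => (gaussWeight α k : ℂ) * u ^ k :=
    summable_gaussWeight_mul hα fun k => (norm_zpow_of_norm_one hu k).le
  have h := norm_tsum_le_of_geometric
    (a := fun k : ℤ => (gaussWeight α k : ℂ) * u ^ k - if k = 0 then 1 else 0)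
    (C := 1) (r := gaussWeight α 1) (gaussWeight_pos α 1).le hq zero_le_one
    (by simp [gaussWeight_zero]) (by
      intro m hm
      simp only [hm, if_false, sub_zero, one_mul]
      rw [norm_mul, norm_zpow_of_norm_one hu, mul_one, Complex.norm_real,
        Real.norm_of_nonneg (gaussWeight_pos α m).le]
      exact gaussWeight_le_pow hα (by simpa using natAbs_le_sq m))
  have h1 : Summable fun k : ℤ => if k = 0 then (1 : ℂ) else 0 := (hasSum_ite_eq 0 1).summable
  have h2 := h.2
  rw [hs.tsum_sub h1, tsum_ite_eq] at h2
  simpa [thetaSeries] using h2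

/-- The increment of the theta series from its value at `-1` is a weighted sum of squares. -/
lemma re_thetaSeries_neg_sub (hα : 0 < α) {u : ℂ} (hu : ‖u‖ = 1) :
    (thetaSeries α (-u)).re - (thetaSeries α (-1)).re =
      ∑' m : ℤ, -((-1) ^ m * gaussWeight α m * (‖u ^ m - 1‖ ^ 2 / 2)) := by
  have hs : ∀ v : ℂ, ‖v‖ = 1 → Summable fun k : ℤ => (gaussWeight α k : ℂ) * v ^ k := fun v hv =>
    summable_gaussWeight_mul hα fun k => (norm_zpow_of_norm_one hv k).le
  have h1 := hs (-u) (by simpa using hu)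
  have h2 := hs (-1) (by simp)
  rw [← Complex.sub_re, thetaSeries, thetaSeries, ← h1.tsum_sub h2, Complex.re_tsum (h1.sub h2)]
  refine tsum_congr fun m => ?_
  have h3 := re_sub_one_of_norm_one (norm_zpow_of_norm_one hu m)
  have h4 : (gaussWeight α m : ℂ) * (-u) ^ m - gaussWeight α m * (-1) ^ m =
      (((-1) ^ m * gaussWeight α m : ℝ) : ℂ) * (u ^ m - 1) := by
    rw [neg_eq_neg_one_mul u, mul_zpow]
    push_cast
    ring
  rw [h4, Complex.re_ofReal_mul, Complex.sub_re, Complex.one_re, h3]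
  ring

lemma natAbs_sq_le_four_pow (m : ℤ) : ((m.natAbs : ℝ)) ^ 2 ≤ 4 ^ m.natAbs := by
  have h : (m.natAbs : ℝ) ≤ 2 ^ m.natAbs := by exact_mod_cast Nat.lt_two_pow_self.le
  calc ((m.natAbs : ℝ)) ^ 2 ≤ (2 ^ m.natAbs) ^ 2 := by gcongr
    _ = 4 ^ m.natAbs := by rw [← pow_mul, mul_comm, pow_mul]; norm_num

/-- Uses `|u^m - 1| ≤ |m| |u - 1|` and absorbs `m²` into the ratio through `m² ≤ 4^|m|`. -/
lemma abs_thetaIncrement_le {u : ℂ} (hu : ‖u‖ = 1) {p : ℝ} {m : ℤ}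
    (hp : gaussWeight α m ≤ p ^ m.natAbs) (hp0 : 0 ≤ p) :
    ‖-((-1) ^ m * gaussWeight α m * (‖u ^ m - 1‖ ^ 2 / 2))‖ ≤
      ‖u - 1‖ ^ 2 / 2 * (4 * p) ^ m.natAbs := by
  have h1 := norm_zpow_sub_one_le hu m
  have h2 : ‖u ^ m - 1‖ ^ 2 ≤ 4 ^ m.natAbs * ‖u - 1‖ ^ 2 := by
    calc ‖u ^ m - 1‖ ^ 2 ≤ (m.natAbs * ‖u - 1‖) ^ 2 := by gcongr
      _ = (m.natAbs : ℝ) ^ 2 * ‖u - 1‖ ^ 2 := by ring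
      _ ≤ _ := by gcongr; exact natAbs_sq_le_four_pow m
  rw [norm_neg, norm_mul, norm_mul, norm_zpow, norm_neg, norm_one, one_zpow, one_mul,
    Real.norm_of_nonneg (gaussWeight_pos α m).le, Real.norm_of_nonneg (by positivity)]
  calc gaussWeight α m * (‖u ^ m - 1‖ ^ 2 / 2)
      ≤ p ^ m.natAbs * (4 ^ m.natAbs * ‖u - 1‖ ^ 2 / 2) := by gcongr
    _ = _ := by rw [mul_pow]; ring

lemma re_thetaSeries_neg_sub_le (hα : 0 < α) (hq : gaussWeight α 1 ≤ 1 / 8) {u : ℂ}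
    (hu : ‖u‖ = 1) :
    (thetaSeries α (-u)).re - (thetaSeries α (-1)).re ≤
      8 * gaussWeight α 1 * ‖u - 1‖ ^ 2 := by
  rw [re_thetaSeries_neg_sub hα hu]
  have h := norm_tsum_le_of_geometric
    (a := fun m : ℤ => -((-1) ^ m * gaussWeight α m * (‖u ^ m - 1‖ ^ 2 / 2)))
    (C := ‖u - 1‖ ^ 2 / 2) (r := 4 * gaussWeight α 1) (by linarith [gaussWeight_pos α 1])
    (by linarith) (by positivity) (by simp) fun m _ => abs_thetaIncrement_le hu
      (gaussWeight_le_pow hα (by simpa using natAbs_le_sq m)) (gaussWeight_pos α 1).le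
  have h2 := (le_abs_self _).trans h.2
  linarith

/-- In the increment from `-1` the terms `m = ±1` contribute `q |v - 1|²`. For `|m| ≥ 2` one has `m²
≥ 2|m|`, so those terms total at most `8 q² |v - 1|²`, which `q ≤ 1/8` makes no larger. -/
lemma re_thetaSeries_neg_one_le (hα : 0 < α) (hq : gaussWeight α 1 ≤ 1 / 8) {u : ℂ}
    (hu : ‖u‖ = 1) : (thetaSeries α (-1)).re ≤ (thetaSeries α u).re := by
  have hu' : ‖-u‖ = 1 := by simpa using hu
  have hmain := re_thetaSeries_neg_sub hα hu'
  rw [neg_neg] at hmain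
  set v := -u
  set q := gaussWeight α 1 with hqdef
  have hq0 : 0 < q := gaussWeight_pos α 1
  set a : ℤ → ℝ := fun m => -((-1) ^ m * gaussWeight α m * (‖v ^ m - 1‖ ^ 2 / 2)) with ha
  set b : ℤ → ℝ := fun m => if m = 1 then q * (‖v - 1‖ ^ 2 / 2) else 0 with hb
  set b' : ℤ → ℝ := fun m => if m = -1 then q * (‖v - 1‖ ^ 2 / 2) else 0 with hb'
  have hinv : ‖v⁻¹ - 1‖ = ‖v - 1‖ := by
    have : v⁻¹ - 1 = -(v⁻¹ * (v - 1)) := by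
      field_simp [ne_zero_of_norm_one hu']
      ring
    rw [this, norm_neg, norm_mul, norm_inv, hu', inv_one, one_mul]
  have h1 : a 1 = q * (‖v - 1‖ ^ 2 / 2) := by simp [ha, hqdef]
  have h2 : a (-1) = q * (‖v - 1‖ ^ 2 / 2) := by simp [ha, hqdef, hinv, gaussWeight_neg]
  have h := norm_tsum_le_of_geometric (a := fun m => a m - (b m + b' m))
    (C := ‖v - 1‖ ^ 2 / 2) (r := 4 * q ^ 2) (by positivity) (by nlinarith) (by positivity)
    (by simp [ha, hb, hb']) (by
      intro m hm
      by_cases hm1 : m = 1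
      · subst hm1
        simp only [h1, hb, hb']
        norm_num
        positivity
      · by_cases hm2 : m = -1
        · subst hm2
          simp only [h2, hb, hb']
          norm_num
          positivity
        · simp only [hb, hb', hm1, hm2, if_false, add_zero, sub_zero]
          refine abs_thetaIncrement_le hu' ?_ (by positivity)
          rw [← pow_mul]
          refine gaussWeight_le_pow hα ?_
          have h3 : 2 ≤ m.natAbs := by omega
          have h4 : m ^ 2 = (m.natAbs : ℤ) * m.natAbs := by rw [← Int.natAbs_sq, sq]
          rw [h4]
          push_cast
          have : (2 : ℤ) ≤ (m.natAbs : ℤ) := by exact_mod_cast h3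
          nlinarith)
  have hbs : HasSum b (q * (‖v - 1‖ ^ 2 / 2)) := hasSum_ite_eq 1 _
  have hbs' : HasSum b' (q * (‖v - 1‖ ^ 2 / 2)) := hasSum_ite_eq (-1) _
  have hsum := (h.1.hasSum.add (hbs.add hbs')).tsum_eq
  simp only [sub_add_cancel] at hsum
  rw [hsum] at hmain
  have h5 := neg_le_of_abs_le h.2
  have h6 : 0 ≤ ‖v - 1‖ ^ 2 := by positivity
  nlinarith [mul_nonneg h6 (mul_nonneg hq0.le (sub_nonneg.2 hq))]

end ThetaBounds

/-! ### Sampling the potential on uniform grids. -/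

section Aliasing

variable {α : ℝ} {n : ℕ} {w : Fin n → ℂ}

/-- The coefficient of frequency `k` seen by the grid `T · {ζ : ζᴸ = 1}`: the sum of the Fourier
coefficients of all frequencies congruent to `k` modulo `L`, with phases. -/
noncomputable def aliasSum (α : ℝ) (w : Fin n → ℂ) (T : ℂ) (L : ℕ) (k : ℤ) : ℂ :=
  ∑' m : ℤ, (gaussWeight α (k + m * L) : ℂ) * (T ^ (-(m * L)) * powSum w (k + m * L))

lemma summable_aliasSum (hα : 0 < α) {L : ℕ} (hL : 0 < L) (k : ℤ) {v : ℤ → ℂ} {C : ℝ}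
    (hv : ∀ m, ‖v m‖ ≤ C) :
    Summable fun m : ℤ => (gaussWeight α (k + m * L) : ℂ) * v m := by
  have hinj : Function.Injective fun m : ℤ => k + m * (L : ℤ) := by
    intro a b hab
    simpa [hL.ne'] using hab
  refine Summable.of_norm_bounded (((summable_gaussWeight hα).comp_injective hinj).mul_right C)
    fun m => ?_
  rw [norm_mul, Complex.norm_real, Real.norm_of_nonneg (gaussWeight_pos α _).le]
  exact mul_le_mul_of_nonneg_left (hv m) (gaussWeight_pos α _).le

lemma sum_zpow_mul_sum_thetaSeries (hα : 0 < α) {L : ℕ} (hL : 0 < L) {ζ : ℂ}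
    (hζ : IsPrimitiveRoot ζ L) {T : ℂ} (hT : ‖T‖ = 1) (hw : ∀ j, ‖w j‖ = 1) (k : ℤ) :
    ∑ l ∈ Finset.range L, (T * ζ ^ l) ^ k * ∑ j, thetaSeries α (w j / (T * ζ ^ l)) =
      L * aliasSum α w T L k := by
  simp only [Finset.mul_sum]
  rw [Finset.sum_comm]
  simp only [sum_zpow_mul_thetaSeries hα hL hζ hT (hw _)]
  rw [← Finset.mul_sum, aliasSum, ← Summable.tsum_finsetSum]
  · simp only [powSum, Finset.mul_sum]
  · intro j _
    refine summable_aliasSum hα hL k (C := 1) fun m => ?_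
    rw [norm_mul, norm_zpow_of_norm_one hT, norm_zpow_of_norm_one (hw j), mul_one]

/-- A potential that is at least `M` has all its non-constant discrete Fourier coefficients bounded
by the excess of its mean over `M`. -/
lemma norm_aliasSum_le (hα : 0 < α) {L : ℕ} (hL : 0 < L) {T : ℂ} (hT : ‖T‖ = 1)
    (hw : ∀ j, ‖w j‖ = 1) {M : ℝ}
    (hM : ∀ S : ℂ, ‖S‖ = 1 → M ≤ (∑ j, thetaSeries α (w j / S)).re) {k : ℤ}
    (hk : ¬ (L : ℤ) ∣ k) : ‖aliasSum α w T L k‖ ≤ (aliasSum α w T L 0).re - M := by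
  set ζ := Complex.exp (2 * Real.pi * Complex.I / L)
  have hζ : IsPrimitiveRoot ζ L := Complex.isPrimitiveRoot_exp L hL.ne'
  have hζ1 : ‖ζ‖ = 1 := hζ.norm'_eq_one hL.ne'
  set F : ℂ → ℂ := fun S => ∑ j, thetaSeries α (w j / S) with hF
  have hS : ∀ l : ℕ, ‖T * ζ ^ l‖ = 1 := fun l => by simp [hT, hζ1]
  have hreal : ∀ S : ℂ, ‖S‖ = 1 → F S = ((F S).re : ℂ) := by
    intro S hS1
    simp only [hF, Complex.re_sum, Complex.ofReal_sum]
    exact Finset.sum_congr rfl fun j _ => (ofReal_re_thetaSeries (by simp [hw, hS1])).symm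
  have hsum0 : ∑ l ∈ Finset.range L, (T * ζ ^ l) ^ k = 0 := by
    have := hζ.sum_zpow k
    rw [if_neg hk] at this
    simp only [mul_zpow, ← Finset.mul_sum, this, mul_zero]
  -- The character sums to zero over the grid, so `M` can be subtracted for free. The triangle
  -- inequality then loses nothing in sign, as `F - M` is nonnegative.
  have h1 : (L : ℂ) * aliasSum α w T L k =
      ∑ l ∈ Finset.range L, (T * ζ ^ l) ^ k * (F (T * ζ ^ l) - M) := by
    simp only [mul_sub, Finset.sum_sub_distrib]
    rw [sum_zpow_mul_sum_thetaSeries hα hL hζ hT hw k, ← Finset.sum_mul, hsum0, zero_mul, sub_zero]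
  have h0 := sum_zpow_mul_sum_thetaSeries hα hL hζ hT hw 0
  simp only [zpow_zero, one_mul] at h0
  have h2 : (L : ℝ) * ‖aliasSum α w T L k‖ ≤ L * ((aliasSum α w T L 0).re - M) := by
    calc (L : ℝ) * ‖aliasSum α w T L k‖ = ‖(L : ℂ) * aliasSum α w T L k‖ := by
          rw [norm_mul, Complex.norm_natCast]
      _ ≤ ∑ l ∈ Finset.range L, ((F (T * ζ ^ l)).re - M) := by
          rw [h1]
          refine norm_sum_le_of_le _ fun l _ => ?_
          rw [norm_mul, norm_zpow_of_norm_one (hS l), one_mul, hreal _ (hS l), ← Complex.ofReal_sub,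
            Complex.norm_real, Complex.ofReal_re,
            Real.norm_of_nonneg (sub_nonneg.2 (hM _ (hS l)))]
      _ = _ := by
          have h3 := congrArg Complex.re h0
          rw [Complex.re_sum, ← Complex.ofReal_natCast, Complex.re_ofReal_mul] at h3
          rw [Finset.sum_sub_distrib, h3, Finset.sum_const, Finset.card_range, nsmul_eq_mul]
          ring
  exact le_of_mul_le_mul_left h2 (by exact_mod_cast hL)

/-- The mean over `n` nodes sees only multiples of `n`, that is, a theta series with parameter `α
n²` in `(w_j / T)^n`. The choice `T^n = -c` places these arguments near the minimizer `-1` when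
`w_j^n` is near `c`. -/
lemma aliasSum_zero_eq (hw : ∀ j, ‖w j‖ = 1) (hα : 0 < α) (hn : 0 < n) {T c : ℂ} (hT : ‖T‖ = 1)
    (hc : T ^ n = -c) :
    aliasSum α w T n 0 = ∑ j, thetaSeries (α * (n : ℝ) ^ 2) (-(w j ^ n / c)) := by
  simp only [aliasSum, powSum, Finset.mul_sum, thetaSeries]
  rw [Summable.tsum_finsetSum]
  · refine Finset.sum_congr rfl fun j _ => tsum_congr fun m => ?_
    have h1 := gaussWeight_mul α m n
    rw [Int.cast_natCast] at h1
    rw [zero_add, h1]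
    congr 1
    rw [← div_neg, ← hc, div_zpow, zpow_neg, ← zpow_natCast, ← zpow_natCast, ← zpow_mul,
      ← zpow_mul, mul_comm m]
    field_simp
  · intro j _
    refine summable_aliasSum hα hn 0 (C := 1) fun m => ?_
    rw [norm_mul, norm_zpow_of_norm_one hT, norm_zpow_of_norm_one (hw j), mul_one]

end Aliasing

/-! ### Rigidity: coarse bound and bootstrap. -/

section Core

variable {α : ℝ} {n : ℕ} {w : Fin n → ℂ}

/-- The minimum of the potential of `n` equispaced points. -/
noncomputable def equispacedMin (α : ℝ) (n : ℕ) : ℝ :=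
  n * (thetaSeries (α * (n : ℝ) ^ 2) (-1)).re

lemma gaussWeight_mul_sq (α : ℝ) (n : ℕ) :
    gaussWeight (α * (n : ℝ) ^ 2) 1 = gaussWeight α n := by
  have := gaussWeight_mul α 1 n
  rw [one_mul] at this
  rw [this, Int.cast_natCast]

lemma card_sub_equispacedMin_le (hα : 0 < α) (hn : 0 < n) (hq : gaussWeight α n ≤ 1 / 2) :
    n - equispacedMin α n ≤ 4 * n * gaussWeight α n := by
  have hn' : (0 : ℝ) < n := by exact_mod_cast hn
  have h := norm_thetaSeries_sub_one_le (α := α * (n : ℝ) ^ 2) (by positivity)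
    (by rwa [gaussWeight_mul_sq]) (u := -1) (by simp)
  rw [gaussWeight_mul_sq] at h
  have h1 := neg_le_of_abs_le ((Complex.abs_re_le_norm _).trans h)
  rw [Complex.sub_re, Complex.one_re] at h1
  unfold equispacedMin
  nlinarith

/-- With `2n` nodes and `k ≤ n/2`, the aliases satisfy `|k + 2nm| ≥ |m| n` and so have weight at
most `q^|m|`. On `n` nodes, `k = n/2` would collide with `-n/2`, which has equal weight. -/
lemma norm_aliasSum_sub_le (hα : 0 < α) (hn : 0 < n) (hq : gaussWeight α n ≤ 1 / 2)
    (hw : ∀ j, ‖w j‖ = 1) {k : ℕ} (hk : 2 * k ≤ n) :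
    ‖aliasSum α w 1 (2 * n) k - gaussWeight α k * powSum w k‖ ≤ 4 * n * gaussWeight α n := by
  set a : ℤ → ℂ := fun m => (gaussWeight α (k + m * (2 * n : ℕ)) : ℂ) *
    ((1 : ℂ) ^ (-(m * (2 * n : ℕ))) * powSum w (k + m * (2 * n : ℕ))) with ha
  have hs : Summable a := summable_aliasSum hα (by omega) k (C := n) fun m => by
    rw [one_zpow, one_mul]
    exact norm_powSum_le hw _
  have h := norm_tsum_le_of_geometric
    (a := fun m : ℤ => a m - if m = 0 then (gaussWeight α k : ℂ) * powSum w k else 0)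
    (C := n) (r := gaussWeight α n) (gaussWeight_pos α n).le hq (Nat.cast_nonneg n)
    (by simp [ha]) (by
      intro m hm
      simp only [ha, hm, if_false, sub_zero, one_zpow, one_mul]
      rw [norm_mul, Complex.norm_real, Real.norm_of_nonneg (gaussWeight_pos α _).le, mul_comm]
      refine mul_le_mul (norm_powSum_le hw _) (gaussWeight_le_pow hα ?_) (gaussWeight_pos α _).le
        (Nat.cast_nonneg n)
      have h1 := natAbs_le_sq m
      have h2 : (1 : ℤ) ≤ m ^ 2 := by
        have := sq_pos_of_ne_zero hm
        omega
      have h3 : (2 : ℤ) * k ≤ n := by exact_mod_cast hk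
      have h4 : (0 : ℤ) ≤ k := Int.natCast_nonneg k
      have h5 : (0 : ℤ) < n := by exact_mod_cast hn
      push_cast
      have h6 : m ^ 2 * n ^ 2 ≤ (k + m * (2 * n : ℤ)) ^ 2 := by
        rcases lt_or_gt_of_ne hm with hm' | hm'
        · have : m * n + (k + m * (2 * n : ℤ)) ≤ 0 := by nlinarith
          have : (k + m * (2 * n : ℤ)) - m * n ≤ 0 := by nlinarith
          nlinarith
        · have : 0 ≤ (k + m * (2 * n : ℤ)) - m * n := by nlinarith
          have : 0 ≤ m * n := by positivity
          nlinarith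
      have h7 : (m.natAbs : ℤ) * n ^ 2 ≤ m ^ 2 * n ^ 2 := by gcongr
      simpa using h7.trans h6)
  have h1 := h.2
  rw [hs.tsum_sub (hasSum_ite_eq 0 _).summable, tsum_ite_eq] at h1
  exact h1

/-- The constant `12` collects `4` from each of three errors: the mean against `n`, `n` against `M`,
and the aliasing at `k`. -/
lemma gaussWeight_mul_norm_powSum_le (hα : 0 < α) (hn : 0 < n) (hq : gaussWeight α n ≤ 1 / 2)
    (hw : ∀ j, ‖w j‖ = 1)
    (hM : ∀ S : ℂ, ‖S‖ = 1 → equispacedMin α n ≤ (∑ j, thetaSeries α (w j / S)).re) {k : ℕ}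
    (hk0 : 0 < k) (hk : 2 * k ≤ n) :
    gaussWeight α k * ‖powSum w k‖ ≤ 12 * n * gaussWeight α n := by
  have h0 := norm_aliasSum_sub_le hα hn hq hw (k := 0) (by omega)
  have h1 := norm_aliasSum_sub_le hα hn hq hw hk
  have hd : ¬ ((2 * n : ℕ) : ℤ) ∣ (k : ℤ) := by
    rw [Int.natCast_dvd_natCast]
    exact fun h => absurd (Nat.le_of_dvd hk0 h) (by omega)
  have h2 := norm_aliasSum_le hα (by omega : 0 < 2 * n) norm_one hw hM hd
  have h3 := card_sub_equispacedMin_le hα hn hq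
  have h4 := (Complex.re_le_norm _).trans h0
  have h5 : powSum w ((0 : ℕ) : ℤ) = n := by simp [powSum]
  rw [h5, Nat.cast_zero, gaussWeight_zero, Complex.ofReal_one, one_mul, Complex.sub_re,
    Complex.natCast_re] at h4
  have h6 : gaussWeight α k * ‖powSum w k‖ = ‖(gaussWeight α k : ℂ) * powSum w k‖ := by
    rw [norm_mul, Complex.norm_real, Real.norm_of_nonneg (gaussWeight_pos α _).le]
  have h7 := norm_le_norm_add_norm_sub (aliasSum α w 1 (2 * n) k)
    ((gaussWeight α k : ℂ) * powSum w k)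
  rw [h6]
  linarith

variable {E : ℝ}

lemma re_aliasSum_zero_sub_le (hα : 0 < α) (hn : 0 < n) (hq : gaussWeight α n ≤ 1 / 8)
    (hw : ∀ j, ‖w j‖ = 1) (hE0 : 0 ≤ E) (hE : ∀ i : ℕ, 0 < i → i < n → ‖elemSymm w i‖ ≤ E)
    {T : ℂ} (hT : ‖T‖ = 1) (hTn : T ^ n = -(-(-1) ^ n * elemSymm w n)) :
    (aliasSum α w T n 0).re - equispacedMin α n ≤ 8 * gaussWeight α n * n ^ 3 * E ^ 2 := by
  have hn' : (0 : ℝ) < n := by exact_mod_cast hn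
  rw [aliasSum_zero_eq hw hα hn hT hTn, equispacedMin, Complex.re_sum]
  set c : ℂ := -(-1) ^ n * elemSymm w n with hc
  have hc1 : ‖c‖ = 1 := by simp [hc, norm_elemSymm_card hw]
  have hj : ∀ j ∈ (Finset.univ : Finset (Fin n)),
      (thetaSeries (α * (n : ℝ) ^ 2) (-(w j ^ n / c))).re ≤
        (thetaSeries (α * (n : ℝ) ^ 2) (-1)).re + 8 * gaussWeight α n * (n * E) ^ 2 := by
    intro j _
    have h := re_thetaSeries_neg_sub_le (α := α * (n : ℝ) ^ 2) (by positivity)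
      (by rwa [gaussWeight_mul_sq]) (u := w j ^ n / c) (by simp [hw, hc1])
    rw [gaussWeight_mul_sq, div_sub_one (ne_zero_of_norm_one hc1), norm_div, hc1, div_one] at h
    have h1 := norm_pow_card_sub_le hw hn hE0 hE j
    have h2 : 8 * gaussWeight α n * ‖w j ^ n - c‖ ^ 2 ≤ 8 * gaussWeight α n * (n * E) ^ 2 := by
      have := gaussWeight_pos α n
      gcongr
    linarith
  have h := Finset.sum_le_sum hj
  rw [Finset.sum_const, Finset.card_univ, Fintype.card_fin, nsmul_eq_mul] at h
  linarith

/-- Main term of the aliased coefficient of frequency `k` on the critical grid: the contributions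
of the frequencies `k` and `k - n` have the same sign. -/
lemma norm_elemSymm_le_norm_add (hw : ∀ j, ‖w j‖ = 1) (hE0 : 0 ≤ E)
    (hE : ∀ i : ℕ, 0 < i → i < n → ‖elemSymm w i‖ ≤ E) (hα : 0 < α) {k : ℕ} (hk0 : 0 < k)
    (hk : 2 * k ≤ n) :
    gaussWeight α k * ‖elemSymm w k‖ ≤
      ‖(gaussWeight α k : ℂ) * powSum w k +
        (gaussWeight α (k - n) : ℂ) * (-(-(-1) ^ n * elemSymm w n) * powSum w (k - n))‖ +
      4 * gaussWeight α k * n ^ 3 * E ^ 2 := by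
  obtain ⟨l, rfl⟩ : ∃ l, n = k + l := ⟨n - k, by omega⟩
  have hl : k ≤ l := by omega
  have hkl : ((k : ℤ) - ((k + l : ℕ) : ℤ)) = -(l : ℤ) := by push_cast; ring
  have hconj : powSum w (-(l : ℤ)) = (starRingEnd ℂ) (powSum w l) := by
    simp only [powSum, map_sum, map_zpow₀]
    exact Finset.sum_congr rfl fun j _ => by
      rw [conj_eq_inv_of_norm_one (hw j), inv_zpow, zpow_neg]
  have hrec : elemSymm w k = elemSymm w (k + l) * (starRingEnd ℂ) (elemSymm w l) := by
    simpa using elemSymm_card_sub hw (k := l) (by omega)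
  have hr1 := norm_powSum_sub_le hw hE0 hE hk0 (by omega)
  have hr2 := norm_powSum_sub_le hw hE0 hE (k := l) (by omega) (by omega)
  rw [← Complex.norm_conj] at hr2
  rw [hkl, gaussWeight_neg, hconj]
  set r1 := powSum w k - (-1) ^ (k + 1) * (k * elemSymm w k) with hr1def
  set r2 := (starRingEnd ℂ) (powSum w l - (-1) ^ (l + 1) * (l * elemSymm w l)) with hr2def
  set e := elemSymm w (k + l) with he
  have hen : ‖-(-(-1) ^ (k + l) * e)‖ = 1 := by simp [he, norm_elemSymm_card hw]
  have hp1 : powSum w k = (-1) ^ (k + 1) * (k * elemSymm w k) + r1 := by simp [hr1def]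
  have hp2 : (starRingEnd ℂ) (powSum w l) =
      (-1) ^ (l + 1) * (l * (starRingEnd ℂ) (elemSymm w l)) + r2 := by
    simp [hr2def]
  have hsign : (-1 : ℂ) ^ (k + l) * (-1) ^ (l + 1) = (-1) ^ (k + 1) := by
    rw [← pow_add, show k + l + (l + 1) = k + 1 + 2 * l by ring, pow_add _ (k + 1), pow_mul]
    simp
  -- By reflection the linear part of the frequency `k - n = -l` is also a multiple of `(-1)^(k+1)
  -- e_k`. The two real coefficients are nonnegative and add without cancellation.
  have hmain : (gaussWeight α k : ℂ) * powSum w k +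
      (gaussWeight α l : ℂ) * (-(-(-1) ^ (k + l) * e) * (starRingEnd ℂ) (powSum w l)) =
      (-1) ^ (k + 1) * elemSymm w k * ((gaussWeight α k * k + gaussWeight α l * l : ℝ) : ℂ) +
        (gaussWeight α k * r1 + gaussWeight α l * (-(-(-1) ^ (k + l) * e) * r2)) := by
    rw [hp1, hp2]
    push_cast
    linear_combination (gaussWeight α l : ℂ) * e * l * (starRingEnd ℂ) (elemSymm w l) * hsign -
      (gaussWeight α l : ℂ) * l * (-1) ^ (k + 1) * hrec
  have hgl : gaussWeight α l ≤ gaussWeight α k := by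
    refine gaussWeight_le hα ?_
    have : (k : ℤ) ≤ l := by exact_mod_cast hl
    gcongr
  have hgk := gaussWeight_pos α k
  have hgl0 := gaussWeight_pos α l
  have herr : ‖(gaussWeight α k : ℂ) * r1 + gaussWeight α l * (-(-(-1) ^ (k + l) * e) * r2)‖ ≤
      4 * gaussWeight α k * ((k + l : ℕ) : ℝ) ^ 3 * E ^ 2 := by
    refine (norm_add_le _ _).trans ?_
    rw [norm_mul, norm_mul, norm_mul, hen, one_mul, Complex.norm_real, Complex.norm_real,
      Real.norm_of_nonneg hgk.le, Real.norm_of_nonneg hgl0.le]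
    have h1 := mul_le_mul_of_nonneg_left hr1 hgk.le
    have h2 := mul_le_mul hgl hr2 (norm_nonneg _) hgk.le
    linarith
  have hlow : gaussWeight α k * ‖elemSymm w k‖ ≤
      ‖(-1) ^ (k + 1) * elemSymm w k *
        ((gaussWeight α k * k + gaussWeight α l * l : ℝ) : ℂ)‖ := by
    rw [norm_mul, norm_mul, norm_pow, norm_neg, norm_one, one_pow, one_mul, Complex.norm_real,
      Real.norm_of_nonneg (by positivity), mul_comm]
    gcongr
    have : (1 : ℝ) ≤ k := by exact_mod_cast hk0
    have : 0 ≤ gaussWeight α l * l := by positivity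
    nlinarith
  have htri := norm_sub_le_norm_add
    ((-1) ^ (k + 1) * elemSymm w k * ((gaussWeight α k * k + gaussWeight α l * l : ℝ) : ℂ))
    ((gaussWeight α k : ℂ) * r1 + gaussWeight α l * (-(-(-1) ^ (k + l) * e) * r2))
  rw [hmain]
  linarith

/-- The alias `k - n` is kept because its weight can equal that of `k`. Every other alias gains a
factor `q^|m|`. The growth `2 + |m| ≤ 3 * 2^|m|` of the power sums turns the ratio into `2q`. -/
lemma norm_aliasSum_sub_sub_le (hα : 0 < α) (hn : 0 < n) (hq : gaussWeight α n ≤ 1 / 8)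
    (hw : ∀ j, ‖w j‖ = 1) (hE0 : 0 ≤ E) (hE : ∀ i : ℕ, 0 < i → i < n → ‖elemSymm w i‖ ≤ E)
    {T : ℂ} (hT : ‖T‖ = 1) {k : ℕ} (hk0 : 0 < k) (hk : 2 * k ≤ n) :
    ‖aliasSum α w T n k - ((gaussWeight α k : ℂ) * powSum w k +
        (gaussWeight α (k - n) : ℂ) * (T ^ n * powSum w (k - n)))‖ ≤
      24 * gaussWeight α k * n ^ 2 * E * gaussWeight α n := by
  set a : ℤ → ℂ := fun m => (gaussWeight α (k + m * n) : ℂ) *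
    (T ^ (-(m * n)) * powSum w (k + m * n)) with ha
  set q := gaussWeight α n with hqdef
  have hq0 : 0 < q := gaussWeight_pos α n
  have hs : Summable a := summable_aliasSum hα hn k (C := n) fun m => by
    rw [norm_mul, norm_zpow_of_norm_one hT, one_mul]
    exact norm_powSum_le hw _
  have ha0 : a 0 = (gaussWeight α k : ℂ) * powSum w k := by simp [ha]
  have ha1 : a (-1) = (gaussWeight α (k - n) : ℂ) * (T ^ n * powSum w (k - n)) := by
    simp [ha, ← sub_eq_add_neg]
  rw [← ha0, ← ha1]
  have hgk := gaussWeight_pos α k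
  have h := norm_tsum_le_of_geometric
    (a := fun m : ℤ => a m - ((if m = 0 then a 0 else 0) + (if m = -1 then a (-1) else 0)))
    (C := 3 * gaussWeight α k * n ^ 2 * E) (r := 2 * q) (by positivity) (by linarith)
    (by positivity) (by simp) (by
      intro m hm
      by_cases hm1 : m = -1
      · simp only [hm1]
        norm_num
        positivity
      · simp only [hm, hm1, if_false, add_zero, sub_zero, ha]
        rw [norm_mul, norm_mul, norm_zpow_of_norm_one hT, one_mul, Complex.norm_real,
          Real.norm_of_nonneg (gaussWeight_pos α _).le]
        have hg : gaussWeight α (k + m * n) ≤ gaussWeight α k * q ^ m.natAbs := by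
          refine gaussWeight_le_mul_pow hα ?_
          have h3 : (2 : ℤ) * k ≤ n := by exact_mod_cast hk
          have h4 : (0 : ℤ) ≤ k := Int.natCast_nonneg k
          have h5 : (0 : ℤ) < n := by exact_mod_cast hn
          rcases lt_or_gt_of_ne hm with hm' | hm'
          · obtain ⟨d, hd⟩ : ∃ d : ℕ, m = -(d : ℤ) := ⟨m.natAbs, by omega⟩
            have hd2 : (2 : ℤ) ≤ d := by omega
            have : m.natAbs = d := by omega
            rw [this, hd]
            -- `(k - d n)² - k² - d n² = d (d - 2) n² + d n (n - 2k)`; nonnegativity needs `d ≥ 2`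
            -- and `2k ≤ n`.
            have e1 : (0 : ℤ) ≤ d * (d - 2) * n ^ 2 := by
              have : (0 : ℤ) ≤ d - 2 := by linarith
              positivity
            have e2 : (0 : ℤ) ≤ d * n * (n - 2 * k) := by
              have : (0 : ℤ) ≤ n - 2 * k := by linarith
              positivity
            nlinarith
          · obtain ⟨d, hd⟩ : ∃ d : ℕ, m = d := ⟨m.natAbs, by omega⟩
            have hd2 : (1 : ℤ) ≤ d := by omega
            have : m.natAbs = d := by omega
            rw [this, hd]
            have e1 : (0 : ℤ) ≤ d * (d - 1) * n ^ 2 := by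
              have : (0 : ℤ) ≤ d - 1 := by linarith
              positivity
            have e2 : (0 : ℤ) ≤ 2 * k * d * n := by positivity
            nlinarith
        have hp := norm_powSum_add_mul_le hw hE0 hE hk0 (by omega) m
        have h6 : (2 + m.natAbs : ℝ) ≤ 3 * 2 ^ m.natAbs := by
          have h7 : m.natAbs + 1 ≤ 2 ^ m.natAbs := Nat.lt_two_pow_self
          have h8 : (m.natAbs + 1 : ℝ) ≤ 2 ^ m.natAbs := by exact_mod_cast h7
          have : (0 : ℝ) ≤ m.natAbs := Nat.cast_nonneg _
          linarith
        calc gaussWeight α (k + m * n) * ‖powSum w (k + m * n)‖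
            ≤ (gaussWeight α k * q ^ m.natAbs) * ((2 + m.natAbs) * n ^ 2 * E) :=
              mul_le_mul hg hp (norm_nonneg _) (by positivity)
          _ ≤ (gaussWeight α k * q ^ m.natAbs) * ((3 * 2 ^ m.natAbs) * n ^ 2 * E) := by gcongr
          _ = _ := by rw [mul_pow]; ring)
  have hs0 : Summable fun m : ℤ => if m = 0 then a 0 else 0 := (hasSum_ite_eq 0 _).summable
  have hs1 : Summable fun m : ℤ => if m = -1 then a (-1) else 0 := (hasSum_ite_eq (-1) _).summable
  have h1 := h.2
  rw [hs.tsum_sub (hs0.add hs1), hs0.tsum_add hs1, tsum_ite_eq, tsum_ite_eq] at h1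
  refine h1.trans_eq ?_
  ring

/-- If the potential of `n` points is nowhere below the minimum for equispaced points, then all
intermediate elementary symmetric polynomials of the points vanish. -/
lemma elemSymm_eq_zero_of_equispacedMin_le (hα : 0 < α) (hn : 0 < n)
    (hsmall : 200 * (n : ℝ) ^ 4 * Real.exp (-(Real.pi * α * n ^ 2 / 2)) < 1)
    (hw : ∀ j, ‖w j‖ = 1)
    (hM : ∀ S : ℂ, ‖S‖ = 1 → equispacedMin α n ≤ (∑ j, thetaSeries α (w j / S)).re) {k : ℕ}
    (hk0 : 0 < k) (hkn : k < n) : elemSymm w k = 0 := by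
  set s := Real.exp (-(Real.pi * α * n ^ 2 / 2)) with hs
  have hs0 : 0 < s := Real.exp_pos _
  have hn1 : (1 : ℝ) ≤ n := by exact_mod_cast hn
  have hsq : gaussWeight α n = s * s := by
    rw [gaussWeight, hs, ← Real.exp_add]
    push_cast
    ring_nf
  have hn4 : (1 : ℝ) ≤ (n : ℝ) ^ 4 := one_le_pow₀ hn1
  have hs200 : s ≤ 1 / 200 := by nlinarith
  have hq : gaussWeight α n ≤ 1 / 8 := by rw [hsq]; nlinarith
  have hqs : gaussWeight α n ≤ s := by rw [hsq]; nlinarith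
  have hgs : ∀ i : ℕ, 2 * i ≤ n → s ≤ gaussWeight α i := by
    intro i hi
    rw [hs, gaussWeight, Real.exp_le_exp]
    have h1 : (2 * i : ℝ) ≤ n := by exact_mod_cast hi
    have h2 : (i : ℝ) ^ 2 ≤ n ^ 2 / 4 := by
      have : (0 : ℝ) ≤ i := Nat.cast_nonneg i
      nlinarith
    have h3 := mul_le_mul_of_nonneg_left h2 (mul_pos Real.pi_pos hα).le
    have h4 : 0 ≤ Real.pi * α * (n : ℝ) ^ 2 := by have := Real.pi_pos; positivity
    push_cast
    linarith
  -- Dividing the coarse bound `12 n s²` by the weight, which is at least `s` on the lower half of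
  -- the frequencies.
  have hpow : ∀ i : ℕ, 0 < i → i ≤ n / 2 → ‖powSum w i‖ ≤ 12 * n * s := by
    intro i hi0 hi
    have h1 := gaussWeight_mul_norm_powSum_le hα hn (hq.trans (by norm_num)) hw hM hi0
      (by omega : 2 * i ≤ n)
    have h2 := mul_le_mul_of_nonneg_right (hgs i (by omega)) (norm_nonneg (powSum w i))
    rw [hsq] at h1
    have h3 : s * ‖powSum w i‖ ≤ s * (12 * n * s) := by linarith
    exact le_of_mul_le_mul_left h3 hs0
  have hns : 200 * (n : ℝ) * s ≤ 1 := by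
    have : (n : ℝ) ≤ n ^ 4 := le_self_pow₀ hn1 (by norm_num)
    nlinarith
  have hsmallE : ∀ i : ℕ, 0 < i → i ≤ n / 2 → ‖elemSymm w i‖ ≤ 12 * n * s :=
    norm_elemSymm_le_of_powSum (by linarith) hpow
  have hrefl : ∀ i : ℕ, i ≤ n → ‖elemSymm w (n - i)‖ = ‖elemSymm w i‖ := by
    intro i hi
    rw [elemSymm_card_sub hw hi, norm_mul, norm_elemSymm_card hw, one_mul, Complex.norm_conj]
  -- This index shows that the lower half is nonempty, so that a maximum exists there.
  obtain ⟨k', hk'0, hk'2, hkk'⟩ : ∃ k' : ℕ, 0 < k' ∧ 2 * k' ≤ n ∧ ‖elemSymm w k'‖ =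
      ‖elemSymm w k‖ := by
    by_cases h : 2 * k ≤ n
    · exact ⟨k, hk0, h, rfl⟩
    · exact ⟨n - k, by omega, by omega, hrefl k hkn.le⟩
  obtain ⟨l, hl, hmax⟩ := Finset.exists_max_image (Finset.Icc 1 (n / 2)) (fun i => ‖elemSymm w i‖)
    ⟨k', by rw [Finset.mem_Icc]; omega⟩
  rw [Finset.mem_Icc] at hl
  set E := ‖elemSymm w l‖ with hEdef
  have hE0 : 0 ≤ E := norm_nonneg _
  have hE : ∀ i : ℕ, 0 < i → i < n → ‖elemSymm w i‖ ≤ E := by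
    intro i hi0 hin
    by_cases h : 2 * i ≤ n
    · exact hmax i (by rw [Finset.mem_Icc]; omega)
    · rw [← hrefl i hin.le]
      exact hmax (n - i) (by rw [Finset.mem_Icc]; omega)
  suffices hE1 : E = 0 by
    have := hE k hk0 hkn
    rw [hE1] at this
    exact norm_le_zero_iff.1 this
  -- The critical grid: its nodes satisfy `S^n = -c`, halfway between the `n`-th roots of `c`.
  obtain ⟨T, hTn⟩ := IsAlgClosed.exists_pow_nat_eq (-(-(-1) ^ n * elemSymm w n)) hn
  have hT : ‖T‖ = 1 := by
    have h1 := congrArg norm hTn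
    rw [norm_pow] at h1
    have h2 : ‖-(-(-1) ^ n * elemSymm w n)‖ = 1 := by simp [norm_elemSymm_card hw]
    rw [h2] at h1
    exact (pow_eq_one_iff_of_nonneg (norm_nonneg _) hn.ne').1 h1
  have hl2 : 2 * l ≤ n := by omega
  have hd : ¬ (n : ℤ) ∣ (l : ℤ) := by
    rw [Int.natCast_dvd_natCast]
    exact fun h => absurd (Nat.le_of_dvd hl.1 h) (by omega)
  have h1 := norm_elemSymm_le_norm_add hw hE0 hE hα hl.1 hl2
  have h2 := norm_aliasSum_sub_sub_le hα hn hq hw hE0 hE hT hl.1 hl2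
  rw [← hTn] at h1
  have h3 := norm_aliasSum_le hα hn hT hw hM hd
  have h4 := re_aliasSum_zero_sub_le hα hn hq hw hE0 hE hT hTn
  have h5 := norm_le_norm_add_norm_sub (aliasSum α w T n l) ((gaussWeight α l : ℂ) * powSum w l +
    (gaussWeight α (l - n) : ℂ) * (T ^ n * powSum w (l - n)))
  have hg0 := gaussWeight_pos α l
  have hgq : gaussWeight α n ≤ gaussWeight α l := hqs.trans (hgs l hl2)
  have h6 : 8 * gaussWeight α n * n ^ 3 * E ^ 2 ≤ 8 * gaussWeight α l * n ^ 3 * E ^ 2 := by gcongr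
  have h7 : 24 * gaussWeight α l * n ^ 2 * E * gaussWeight α n ≤
      24 * gaussWeight α l * n ^ 2 * E * s := by gcongr
  rw [← hEdef] at h1
  have h8 : gaussWeight α l * E ≤ gaussWeight α l * (12 * n ^ 3 * E ^ 2 + 24 * n ^ 2 * E * s) := by
    linarith
  have h9 := le_of_mul_le_mul_left h8 hg0
  have h10 : E ≤ 12 * n * s := hsmallE l hl.1 hl.2
  have h11 : 12 * (n : ℝ) ^ 3 * E ^ 2 ≤ 12 * (n : ℝ) ^ 3 * (E * (12 * n * s)) := by
    rw [sq]
    gcongr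
  have h12 : 24 * (n : ℝ) ^ 2 * E * s ≤ 24 * (n : ℝ) ^ 4 * E * s := by
    gcongr
    norm_num
  -- One factor `E` of the quadratic term is replaced by the coarse bound `12 n s`; then `168 = 12 *
  -- 12 + 24`.
  have h13 : E ≤ E * (168 * (n : ℝ) ^ 4 * s) := by nlinarith
  have h14 : 168 * (n : ℝ) ^ 4 * s < 1 := by
    have : 0 ≤ (n : ℝ) ^ 4 * s := by positivity
    linarith
  nlinarith

/-- If the potential of `n` points is nowhere below the minimum for equispaced points, then the
points have the same `n`-th power. -/
lemma exists_pow_eq_of_equispacedMin_le (hα : 0 < α) (hn : 0 < n)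
    (hsmall : 200 * (n : ℝ) ^ 4 * Real.exp (-(Real.pi * α * n ^ 2 / 2)) < 1)
    (hw : ∀ j, ‖w j‖ = 1)
    (hM : ∀ S : ℂ, ‖S‖ = 1 → equispacedMin α n ≤ (∑ j, thetaSeries α (w j / S)).re) :
    ∃ c : ℂ, ‖c‖ = 1 ∧ ∀ j, w j ^ n = c := by
  refine ⟨-(-1) ^ n * elemSymm w n, by simp [norm_elemSymm_card hw], fun j => ?_⟩
  have h := norm_pow_card_sub_le hw hn le_rfl (fun i h0 h1 => by
    rw [elemSymm_eq_zero_of_equispacedMin_le hα hn hsmall hw hM h0 h1, norm_zero]) j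
  rw [mul_zero] at h
  exact sub_eq_zero.1 (norm_le_zero_iff.1 h)

end Core

/-! ### The extremal problem on the torus. -/

section Torus

open scoped Classical

variable {α : ℝ} {n : ℕ}

lemma thetaSeries_inv (α : ℝ) (u : ℂ) : thetaSeries α u⁻¹ = thetaSeries α u := by
  rw [thetaSeries, ← (Equiv.neg ℤ).tsum_eq]
  refine tsum_congr fun k => ?_
  rw [Equiv.neg_apply, gaussWeight_neg, inv_zpow, zpow_neg, inv_inv]

lemma torusTheta_eq_re_thetaSeries (α : ℝ) (t : UnitAddCircle) :
    torusTheta α t = (thetaSeries α (AddCircle.toCircle t : ℂ)).re := by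
  unfold torusTheta thetaSeries
  refine congrArg Complex.re (tsum_congr fun k => ?_)
  rw [fourier_apply, AddCircle.toCircle_zsmul, Circle.coe_zpow, gaussWeight]

lemma coe_toCircle_sub (s t : UnitAddCircle) :
    (AddCircle.toCircle (s - t) : ℂ) =
      (AddCircle.toCircle s : ℂ) / (AddCircle.toCircle t : ℂ) := by
  rw [sub_eq_add_neg, AddCircle.toCircle_add, AddCircle.toCircle_neg, Circle.coe_mul,
    Circle.coe_inv, div_eq_mul_inv]

lemma thetaSum_eq_re_sum (α : ℝ) (x : Fin n → UnitAddCircle) (t : UnitAddCircle) :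
    thetaSum α x t = (∑ j, thetaSeries α
      ((AddCircle.toCircle (x j) : ℂ) / (AddCircle.toCircle t : ℂ))).re := by
  rw [thetaSum, Complex.re_sum]
  refine Finset.sum_congr rfl fun j _ => ?_
  rw [torusTheta_eq_re_thetaSeries, coe_toCircle_sub, ← thetaSeries_inv, inv_div]

lemma exists_toCircle_eq {S : ℂ} (hS : ‖S‖ = 1) :
    ∃ t : UnitAddCircle, (AddCircle.toCircle t : ℂ) = S := by
  obtain ⟨t, ht⟩ := (AddCircle.homeomorphCircle (T := 1) one_ne_zero).surjective
    ⟨S, mem_sphere_zero_iff_norm.2 hS⟩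
  refine ⟨t, ?_⟩
  rw [AddCircle.homeomorphCircle_apply] at ht
  rw [ht]

lemma continuous_torusTheta (hα : 0 < α) : Continuous (torusTheta α) := by
  refine Complex.continuous_re.comp (continuous_tsum (u := gaussWeight α) (fun k => by fun_prop)
    (summable_gaussWeight hα) fun k t => ?_)
  rw [norm_mul, fourier_apply, Circle.norm_coe, mul_one, Complex.norm_real,
    Real.norm_of_nonneg (Real.exp_pos _).le, gaussWeight]

lemma exists_isMinOn_thetaSum (hα : 0 < α) (x : Fin n → UnitAddCircle) :
    ∃ t₀, ∀ t, thetaSum α x t₀ ≤ thetaSum α x t := by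
  have hc : Continuous (thetaSum α x) :=
    continuous_finsetSum _ fun j _ => (continuous_torusTheta hα).comp (continuous_sub_right _)
  obtain ⟨t₀, -, h⟩ := isCompact_univ.exists_isMinOn Set.univ_nonempty hc.continuousOn
  exact ⟨t₀, fun t => h (Set.mem_univ t)⟩

lemma bddBelow_range_thetaSum (hα : 0 < α) (x : Fin n → UnitAddCircle) :
    BddBelow (Set.range (thetaSum α x)) := by
  obtain ⟨t₀, h⟩ := exists_isMinOn_thetaSum hα x
  exact ⟨_, Set.forall_mem_range.2 h⟩

lemma isLeast_range_thetaSum (hα : 0 < α) (x : Fin n → UnitAddCircle) :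
    IsLeast (Set.range (thetaSum α x)) (⨅ t, thetaSum α x t) := by
  obtain ⟨t₀, h⟩ := exists_isMinOn_thetaSum hα x
  have : IsLeast (Set.range (thetaSum α x)) (thetaSum α x t₀) :=
    ⟨⟨t₀, rfl⟩, Set.forall_mem_range.2 h⟩
  rwa [iInf, this.csInf_eq]

/-- The points `z, z + 1/n, …, z + (n-1)/n` of the torus. -/
noncomputable def equispacedTorus (n : ℕ) (z : UnitAddCircle) (j : Fin n) : UnitAddCircle :=
  z + (((j : ℝ) / (n : ℝ) : ℝ) : UnitAddCircle)

lemma coe_toCircle_equispacedTorus (z : UnitAddCircle) (j : Fin n) :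
    (AddCircle.toCircle (equispacedTorus n z j) : ℂ) =
      AddCircle.toCircle z * Complex.exp (2 * Real.pi * Complex.I / n) ^ (j : ℕ) := by
  rw [equispacedTorus, AddCircle.toCircle_add, Circle.coe_mul, AddCircle.toCircle_apply_mk,
    Circle.coe_exp, ← Complex.exp_nat_mul]
  congr 2
  push_cast
  ring

lemma injective_coe_toCircle :
    Function.Injective fun t : UnitAddCircle => (AddCircle.toCircle t : ℂ) :=
  Circle.coe_injective.comp (AddCircle.injective_toCircle one_ne_zero)

lemma injective_equispacedTorus (hn : 0 < n) (z : UnitAddCircle) :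
    Function.Injective (equispacedTorus n z) := by
  intro i j hij
  have h := congrArg (fun t : UnitAddCircle => (AddCircle.toCircle t : ℂ)) hij
  simp only [coe_toCircle_equispacedTorus] at h
  have h1 := mul_left_cancel₀ (Circle.coe_ne_zero _) h
  exact Fin.ext ((Complex.isPrimitiveRoot_exp n hn.ne').pow_inj i.2 j.2 h1)

/-- The root-of-unity average at frequency `0` keeps only multiples of `n`, which rescales `α` to `α
n²`. -/
lemma thetaSum_equispacedTorus (hα : 0 < α) (hn : 0 < n) (z t : UnitAddCircle) :
    thetaSum α (equispacedTorus n z) t = n * (thetaSeries (α * (n : ℝ) ^ 2)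
      (((AddCircle.toCircle t : ℂ) / (AddCircle.toCircle z : ℂ)) ^ n)).re := by
  set T : ℂ := (AddCircle.toCircle z : ℂ)
  set S : ℂ := (AddCircle.toCircle t : ℂ)
  have hT : ‖T‖ = 1 := Circle.norm_coe _
  have hS : ‖S‖ = 1 := Circle.norm_coe _
  have h := sum_zpow_mul_thetaSeries hα hn (Complex.isPrimitiveRoot_exp n hn.ne') hT hS 0
  simp only [zpow_zero, one_mul, zero_add] at h
  have h2 : ∑' m : ℤ, (gaussWeight α (m * n) : ℂ) * (T ^ (-(m * n : ℤ)) * S ^ (m * n : ℤ)) =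
      thetaSeries (α * (n : ℝ) ^ 2) ((S / T) ^ n) := by
    refine tsum_congr fun m => ?_
    have h1 := gaussWeight_mul α m n
    rw [Int.cast_natCast] at h1
    rw [h1, ← zpow_natCast (S / T) n, ← zpow_mul, mul_comm (n : ℤ), div_zpow, zpow_neg, div_eq_inv_mul]
  rw [h2] at h
  have h3 : thetaSum α (equispacedTorus n z) t = (∑ l ∈ Finset.range n,
      thetaSeries α (S / (T * Complex.exp (2 * Real.pi * Complex.I / n) ^ l))).re := by
    rw [thetaSum_eq_re_sum, ← Fin.sum_univ_eq_sum_range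
      (fun l => thetaSeries α (S / (T * Complex.exp (2 * Real.pi * Complex.I / n) ^ l)))]
    refine congrArg Complex.re (Finset.sum_congr rfl fun j _ => ?_)
    rw [coe_toCircle_equispacedTorus, ← thetaSeries_inv, inv_div]
  rw [h3, h, ← Complex.ofReal_natCast, Complex.re_ofReal_mul]

lemma iInf_thetaSum_equispacedTorus (hα : 0 < α) (hn : 0 < n) (hq : gaussWeight α n ≤ 1 / 8)
    (z : UnitAddCircle) : ⨅ t, thetaSum α (equispacedTorus n z) t = equispacedMin α n := by
  have hn' : (0 : ℝ) < n := by exact_mod_cast hn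
  have hT : ‖(AddCircle.toCircle z : ℂ)‖ = 1 := Circle.norm_coe _
  refine IsLeast.csInf_eq ⟨?_, Set.forall_mem_range.2 fun t => ?_⟩
  -- The minimum sits midway between neighbouring points, where the `n`-th power of the ratio is
  -- `-1`.
  · obtain ⟨v, hv⟩ := IsAlgClosed.exists_pow_nat_eq (-1 : ℂ) hn
    have hv1 : ‖v‖ = 1 := by
      have h1 := congrArg norm hv
      rw [norm_pow, norm_neg, norm_one] at h1
      exact (pow_eq_one_iff_of_nonneg (norm_nonneg _) hn.ne').1 h1
    obtain ⟨t, ht⟩ := exists_toCircle_eq (S := v * AddCircle.toCircle z)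
      (by rw [norm_mul, hv1, hT, one_mul])
    refine ⟨t, ?_⟩
    beta_reduce
    rw [thetaSum_equispacedTorus hα hn, ht, mul_div_cancel_right₀ _ (ne_zero_of_norm_one hT), hv,
      equispacedMin]
  · rw [thetaSum_equispacedTorus hα hn, equispacedMin]
    refine mul_le_mul_of_nonneg_left (re_thetaSeries_neg_one_le (by positivity) ?_ ?_) hn'.le
    · rwa [gaussWeight_mul_sq]
    · rw [norm_pow, norm_div, hT, Circle.norm_coe, div_one, one_pow]

lemma thetaSum_congr_range {x y : Fin n → UnitAddCircle} (hx : Function.Injective x)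
    (hy : Function.Injective y) (h : Set.range x = Set.range y) :
    thetaSum α x = thetaSum α y := by
  funext t
  have h1 : Finset.univ.image x = Finset.univ.image y := by
    rw [← Finset.coe_inj]
    simpa using h
  unfold thetaSum
  rw [← Finset.sum_image (f := fun p => torusTheta α (t - p)) hx.injOn, h1,
    Finset.sum_image hy.injOn]

lemma isEquispacedTorus_of_equispacedMin_le (hα : 0 < α) (hn : 0 < n)
    (hsmall : 200 * (n : ℝ) ^ 4 * Real.exp (-(Real.pi * α * n ^ 2 / 2)) < 1)
    {x : Fin n → UnitAddCircle} (hx : Function.Injective x)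
    (h : equispacedMin α n ≤ ⨅ t, thetaSum α x t) : IsEquispacedTorus x := by
  obtain ⟨c, hc, hxc⟩ := exists_pow_eq_of_equispacedMin_le hα hn hsmall
    (w := fun j => (AddCircle.toCircle (x j) : ℂ)) (fun j => Circle.norm_coe _) (by
      intro S hS
      obtain ⟨t, rfl⟩ := exists_toCircle_eq hS
      rw [← thetaSum_eq_re_sum]
      exact h.trans (ciInf_le (bddBelow_range_thetaSum hα x) t))
  refine ⟨x ⟨0, hn⟩, ?_⟩
  change Set.range x = Set.range (equispacedTorus n (x ⟨0, hn⟩))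
  -- All points lie in one coset of the `n`-th roots of unity; as `n` distinct points they fill it.
  have hsub : Finset.univ.image x ⊆ Finset.univ.image (equispacedTorus n (x ⟨0, hn⟩)) := by
    intro p hp
    obtain ⟨j, -, rfl⟩ := Finset.mem_image.1 hp
    have h0 : (AddCircle.toCircle (x ⟨0, hn⟩) : ℂ) ≠ 0 := Circle.coe_ne_zero _
    have h1 : ((AddCircle.toCircle (x j) : ℂ) / AddCircle.toCircle (x ⟨0, hn⟩)) ^ n = 1 := by
      rw [div_pow, hxc, hxc, div_self (ne_zero_of_norm_one hc)]
    have : NeZero n := ⟨hn.ne'⟩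
    obtain ⟨i, hi, hi2⟩ := (Complex.isPrimitiveRoot_exp n hn.ne').eq_pow_of_pow_eq_one h1
    refine Finset.mem_image.2 ⟨⟨i, hi⟩, Finset.mem_univ _, injective_coe_toCircle ?_⟩
    simp only [coe_toCircle_equispacedTorus, hi2]
    field_simp
  have heq := Finset.eq_of_subset_of_card_le hsub (by
    rw [Finset.card_image_of_injective _ hx]
    exact Finset.card_image_le)
  have := congrArg (fun s : Finset UnitAddCircle => (s : Set UnitAddCircle)) heq
  simpa using this

/-- Both directions follow from rigidity. A maximizer has minimum at least `M`, hence is equispaced.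
A competitor exceeding `M` would be equispaced too, and so have minimum exactly `M`. -/
lemma isMaxOn_iInf_thetaSum_iff (hα : 0 < α) (hn : 0 < n)
    (hsmall : 200 * (n : ℝ) ^ 4 * Real.exp (-(Real.pi * α * n ^ 2 / 2)) < 1)
    {x : Fin n → UnitAddCircle} (hx : x ∈ torusPoints n) :
    IsMaxOn (fun y => ⨅ t : UnitAddCircle, thetaSum α y t) (torusPoints n) x ↔
      IsEquispacedTorus x := by
  have hq : gaussWeight α n ≤ 1 / 8 := by
    set s := Real.exp (-(Real.pi * α * n ^ 2 / 2)) with hs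
    have hs0 : 0 < s := Real.exp_pos _
    have hsq : gaussWeight α n = s * s := by
      rw [gaussWeight, hs, ← Real.exp_add]
      push_cast
      ring_nf
    have hn4 : (1 : ℝ) ≤ (n : ℝ) ^ 4 := one_le_pow₀ (by exact_mod_cast hn)
    have hs200 : s ≤ 1 / 200 := by nlinarith
    rw [hsq]
    nlinarith
  have hval : ∀ y ∈ torusPoints n, IsEquispacedTorus y →
      ⨅ t, thetaSum α y t = equispacedMin α n := by
    rintro y hy ⟨z, hz⟩
    rw [thetaSum_congr_range hy (injective_equispacedTorus hn z) hz]
    exact iInf_thetaSum_equispacedTorus hα hn hq z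
  constructor
  · intro h
    refine isEquispacedTorus_of_equispacedMin_le hα hn hsmall hx ?_
    rw [← iInf_thetaSum_equispacedTorus hα hn hq 0]
    exact h (injective_equispacedTorus hn 0)
  · intro h y hy
    change ⨅ t, thetaSum α y t ≤ ⨅ t, thetaSum α x t
    rw [hval x hx h]
    by_contra! hlt
    exact hlt.ne' (hval y hy (isEquispacedTorus_of_equispacedMin_le hα hn hsmall hy hlt.le))

end Torus

/-! ### The threshold for `n`. -/

/-- From `exp x ≥ x³ / 6` at `x = b n²` it suffices that `b³ n² > 1200`, which `n > 1200 / b³`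
ensures. -/
lemma exists_forall_pow_mul_exp_lt {α : ℝ} (hα : 0 < α) :
    ∃ N : ℕ, 0 < N ∧ ∀ n : ℕ, N ≤ n →
      200 * (n : ℝ) ^ 4 * Real.exp (-(Real.pi * α * n ^ 2 / 2)) < 1 := by
  set b := Real.pi * α / 2 with hb
  have hb0 : 0 < b := by have := Real.pi_pos; positivity
  refine ⟨⌈1200 / b ^ 3⌉₊ + 1, by omega, fun n hn => ?_⟩
  have h1 : 1200 / b ^ 3 < n := by
    refine (Nat.le_ceil _).trans_lt ?_
    exact_mod_cast hn
  have h2 : (1 : ℝ) ≤ n := by exact_mod_cast (by omega : 1 ≤ n)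
  have h3 := Real.pow_div_factorial_le_exp (b * (n : ℝ) ^ 2) (by positivity) 3
  have h4 : Real.pi * α * (n : ℝ) ^ 2 / 2 = b * (n : ℝ) ^ 2 := by rw [hb]; ring
  rw [h4, Real.exp_neg, ← div_eq_mul_inv, div_lt_one (Real.exp_pos _)]
  refine lt_of_lt_of_le ?_ h3
  rw [div_lt_iff₀ (by positivity)] at h1
  have h5 : (n : ℝ) * b ^ 3 ≤ n ^ 2 * b ^ 3 := by
    gcongr
    nlinarith
  have h6 : (0 : ℝ) < (n : ℝ) ^ 4 := by positivity
  have h7 : (Nat.factorial 3 : ℝ) = 6 := by norm_num [Nat.factorial]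
  rw [h7, lt_div_iff₀ (by norm_num)]
  nlinarith

/-! ### Poisson summation: from the line to the torus. -/

section Line

variable {α : ℝ} {n : ℕ}

lemma summable_exp_neg_mul_sub_sq (hα : 0 < α) (s : ℝ) :
    Summable fun m : ℤ => Real.exp (-Real.pi * α * (s - m) ^ 2) := by
  refine (HurwitzKernelBounds.summable_f_int 0 (-s) hα).congr fun m => ?_
  simp only [HurwitzKernelBounds.f_int, pow_zero, one_mul]
  ring_nf

/-- Poisson summation for the Gaussian, in terms of the theta function of the torus. -/
lemma tsum_exp_neg_mul_sub_sq (hα : 0 < α) (s : ℝ) :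
    ∑' m : ℤ, Real.exp (-Real.pi * α * (s - m) ^ 2) =
      (1 / α) ^ (1 / 2 : ℝ) * torusTheta (1 / α) (s : UnitAddCircle) := by
  have ha : 0 < 1 / α := by positivity
  -- The imaginary shift `I * s` produces the character on one side and, as `I * (I * s) = -s`, the
  -- real translate on the other.
  have h := Complex.tsum_exp_neg_quadratic (a := ((1 / α : ℝ) : ℂ))
    (by rw [Complex.ofReal_re]; exact ha) (Complex.I * s)
  have hl : (torusTheta (1 / α) (s : UnitAddCircle) : ℂ) =
      ∑' k : ℤ, Complex.exp (-Real.pi * ((1 / α : ℝ) : ℂ) * k ^ 2 +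
        2 * Real.pi * (Complex.I * s) * k) := by
    rw [ofReal_torusTheta]
    refine tsum_congr fun k => ?_
    rw [fourier_coe_apply, Complex.exp_add, Complex.ofReal_exp]
    push_cast
    congr 2
    ring
  have hr : ((∑' m : ℤ, Real.exp (-Real.pi * α * (s - m) ^ 2) : ℝ) : ℂ) =
      ∑' k : ℤ, Complex.exp (-Real.pi / ((1 / α : ℝ) : ℂ) * (k + Complex.I * (Complex.I * s)) ^ 2)
      := by
    rw [Complex.ofReal_tsum]
    refine tsum_congr fun k => ?_
    rw [Complex.ofReal_exp]
    congr 1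
    have hαC : (α : ℂ) ≠ 0 := by exact_mod_cast hα.ne'
    rw [← mul_assoc, Complex.I_mul_I]
    push_cast
    field_simp
    ring
  rw [← hl, ← hr] at h
  have hpow : (((1 / α : ℝ) : ℂ) ^ (1 / 2 : ℂ)) = (((1 / α) ^ (1 / 2 : ℝ) : ℝ) : ℂ) := by
    rw [Complex.ofReal_cpow ha.le]
    norm_num
  have hpos : 0 < (1 / α) ^ (1 / 2 : ℝ) := Real.rpow_pos_of_pos ha _
  rw [hpow] at h
  have h2 : torusTheta (1 / α) (s : UnitAddCircle) =
      1 / (1 / α) ^ (1 / 2 : ℝ) * ∑' m : ℤ, Real.exp (-Real.pi * α * (s - m) ^ 2) := by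
    exact_mod_cast h
  rw [h2, ← mul_assoc, mul_one_div_cancel hpos.ne', one_mul]

lemma coe_intCast_unitAddCircle (m : ℤ) : ((m : ℝ) : UnitAddCircle) = 0 :=
  AddCircle.coe_eq_zero_iff (1 : ℝ) |>.2 ⟨m, by simp⟩

lemma coe_eq_coe_unitAddCircle_iff {y z : ℝ} :
    (y : UnitAddCircle) = z ↔ ∃ m : ℤ, y = m + z := by
  rw [← sub_eq_zero, ← AddCircle.coe_sub, AddCircle.coe_eq_zero_iff]
  refine exists_congr fun m => ?_
  rw [zsmul_one, eq_sub_iff_add_eq, eq_comm]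

lemma injective_coe_comp {x : Fin n → ℝ} (hx : x ∈ periodPoints n) :
    Function.Injective fun j => (x j : UnitAddCircle) := by
  intro i j hij
  refine hx.2 ((AddCircle.coe_eq_coe_iff_of_mem_Ico (p := (1 : ℝ)) (a := 0) ?_ ?_).1 hij)
  · simpa using hx.1 i
  · simpa using hx.1 j

lemma periodicConfig_eq_preimage (x : Fin n → ℝ) :
    periodicConfig x =
      (fun t : ℝ => (t : UnitAddCircle)) ⁻¹' Set.range fun j => (x j : UnitAddCircle) := by
  ext y
  simp only [periodicConfig, Set.mem_iUnion, Set.mem_ofPred_eq, Set.mem_preimage, Set.mem_range]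
  refine exists_congr fun k => ?_
  rw [eq_comm (a := (x k : UnitAddCircle)), coe_eq_coe_unitAddCircle_iff]

/-- Distinct points of `[0, 1)` stay distinct modulo `1`, so `Γ` is indexed without repetition by
`Fin n × ℤ`. The sum over it therefore splits into `n` periodized Gaussians. -/
lemma gaussianPotential_periodicConfig (hα : 0 < α) {x : Fin n → ℝ} (hx : x ∈ periodPoints n)
    (t : ℝ) : gaussianPotential α (periodicConfig x) t =
      (1 / α) ^ (1 / 2 : ℝ) * thetaSum (1 / α) (fun j => (x j : UnitAddCircle)) t := by
  set φ : Fin n × ℤ → ℝ := fun p => p.2 + x p.1 with hφ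
  have hrange : periodicConfig x = Set.range φ := by
    ext y
    simp [periodicConfig, hφ, eq_comm]
  have hinj : Function.Injective φ := by
    rintro ⟨i, a⟩ ⟨j, b⟩ hab
    simp only [hφ] at hab
    have hij : i = j := by
      refine injective_coe_comp hx ?_
      have := congrArg (fun y : ℝ => (y : UnitAddCircle)) hab
      simpa [AddCircle.coe_add, coe_intCast_unitAddCircle] using this
    subst hij
    simpa using hab
  have hs : ∀ j, Summable fun m : ℤ => Real.exp (-Real.pi * α * (t - φ (j, m)) ^ 2) := fun j => by
    refine (summable_exp_neg_mul_sub_sq hα (t - x j)).congr fun m => ?_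
    simp only [hφ]
    ring_nf
  have hsum : Summable fun p : Fin n × ℤ => Real.exp (-Real.pi * α * (t - φ p) ^ 2) :=
    (summable_prod_of_nonneg fun p => (Real.exp_pos _).le).2 ⟨hs, (hasSum_fintype _).summable⟩
  rw [gaussianPotential, hrange,
    tsum_range (fun γ : ℝ => Real.exp (-Real.pi * α * (t - γ) ^ 2)) hinj,
    hsum.tsum_prod, tsum_fintype, thetaSum, Finset.mul_sum]
  refine Finset.sum_congr rfl fun j _ => ?_
  rw [← AddCircle.coe_sub, ← tsum_exp_neg_mul_sub_sq hα]
  refine tsum_congr fun m => ?_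
  simp only [hφ]
  ring_nf

end Line

/-! ### Transfer of equispacing, minima and maximizers. -/

section LineTorus

variable {α : ℝ} {n : ℕ}

lemma range_add_div_eq_preimage (hn : 0 < n) (z : ℝ) :
    Set.range (fun j : ℤ => z + (j : ℝ) / (n : ℝ)) =
      (fun t : ℝ => (t : UnitAddCircle)) ⁻¹' Set.range (equispacedTorus n (z : UnitAddCircle)) := by
  have hn' : (n : ℝ) ≠ 0 := by exact_mod_cast hn.ne'
  have hnz : (n : ℤ) ≠ 0 := by exact_mod_cast hn.ne'
  ext y
  simp only [Set.mem_range, Set.mem_preimage, equispacedTorus, ← AddCircle.coe_add]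
  constructor
  · rintro ⟨j, rfl⟩
    have h1 := Int.emod_nonneg j hnz
    have h2 := Int.emod_lt_of_pos j (by exact_mod_cast hn : (0 : ℤ) < n)
    have h3 := Int.mul_ediv_add_emod j n
    have h4 : ((j % n).toNat : ℤ) = j % n := Int.toNat_of_nonneg h1
    refine ⟨⟨(j % n).toNat, by omega⟩, ?_⟩
    rw [eq_comm, coe_eq_coe_unitAddCircle_iff]
    refine ⟨j / n, ?_⟩
    rw [← h4] at h3
    have h5 : (n : ℝ) * ((j / n : ℤ) : ℝ) + ((j % n).toNat : ℝ) = j := by exact_mod_cast h3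
    rw [← h5]
    field_simp
    ring
  · rintro ⟨i, hi⟩
    rw [eq_comm, coe_eq_coe_unitAddCircle_iff] at hi
    obtain ⟨m, rfl⟩ := hi
    refine ⟨i + m * n, ?_⟩
    push_cast
    field_simp
    ring

lemma isEquispacedLine_iff (hn : 0 < n) (x : Fin n → ℝ) :
    IsEquispacedLine n (periodicConfig x) ↔
      IsEquispacedTorus fun j => (x j : UnitAddCircle) := by
  have hsurj : Function.Surjective fun t : ℝ => (t : UnitAddCircle) :=
    QuotientAddGroup.mk_surjective
  have key : ∀ z : ℝ, periodicConfig x = Set.range (fun j : ℤ => z + (j : ℝ) / (n : ℝ)) ↔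
      Set.range (fun j => (x j : UnitAddCircle)) = Set.range (equispacedTorus n z) := fun z => by
    rw [periodicConfig_eq_preimage, range_add_div_eq_preimage hn,
      hsurj.preimage_injective.eq_iff]
  constructor
  · rintro ⟨z, hz⟩
    exact ⟨z, (key z).1 hz⟩
  · rintro ⟨z, hz⟩
    obtain ⟨z, rfl⟩ := hsurj z
    exact ⟨z, (key z).2 hz⟩

lemma exists_periodPoints_eq {y : Fin n → UnitAddCircle} (hy : y ∈ torusPoints n) :
    ∃ x ∈ periodPoints n, (fun j => (x j : UnitAddCircle)) = y := by
  have hc : ∀ j, ((AddCircle.equivIco (1 : ℝ) 0 (y j) : ℝ) : UnitAddCircle) = y j := fun j =>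
    (AddCircle.equivIco (1 : ℝ) 0).symm_apply_apply (y j)
  refine ⟨fun j => AddCircle.equivIco (1 : ℝ) 0 (y j), ⟨fun j => ?_, fun i j hij => ?_⟩, funext hc⟩
  · simpa using (AddCircle.equivIco (1 : ℝ) 0 (y j)).2
  · refine hy ?_
    rw [← hc i, ← hc j]
    exact congrArg _ hij

lemma iInf_gaussianPotential (hα : 0 < α) {x : Fin n → ℝ} (hx : x ∈ periodPoints n) :
    ⨅ t : ℝ, gaussianPotential α (periodicConfig x) t =
      (1 / α) ^ (1 / 2 : ℝ) * ⨅ t, thetaSum (1 / α) (fun j => (x j : UnitAddCircle)) t := by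
  have hsurj : Function.Surjective fun t : ℝ => (t : UnitAddCircle) :=
    QuotientAddGroup.mk_surjective
  rw [← hsurj.iInf_comp, Real.mul_iInf_of_nonneg (Real.rpow_nonneg (by positivity) _)]
  exact iInf_congr (gaussianPotential_periodicConfig hα hx)

lemma isLeast_range_gaussianPotential (hα : 0 < α) {x : Fin n → ℝ} (hx : x ∈ periodPoints n) :
    IsLeast (Set.range (gaussianPotential α (periodicConfig x)))
      (⨅ t : ℝ, gaussianPotential α (periodicConfig x) t) := by
  have hpos : 0 ≤ (1 / α) ^ (1 / 2 : ℝ) := Real.rpow_nonneg (by positivity) _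
  obtain ⟨⟨t₀, h₀⟩, hle⟩ := isLeast_range_thetaSum (by positivity : 0 < 1 / α)
    fun j => (x j : UnitAddCircle)
  rw [iInf_gaussianPotential hα hx]
  refine ⟨?_, Set.forall_mem_range.2 fun t => ?_⟩
  · obtain ⟨t, rfl⟩ := QuotientAddGroup.mk_surjective t₀
    exact ⟨t, by rw [gaussianPotential_periodicConfig hα hx, ← h₀]⟩
  · rw [gaussianPotential_periodicConfig hα hx]
    exact mul_le_mul_of_nonneg_left (hle ⟨_, rfl⟩) hpos

/-- The Poisson factor is positive and independent of the configuration, and every torus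
configuration has representatives in `[0, 1)`. -/
lemma isMaxOn_iInf_gaussianPotential_iff (hα : 0 < α) {x : Fin n → ℝ} (hx : x ∈ periodPoints n) :
    IsMaxOn (fun y => ⨅ t : ℝ, gaussianPotential α (periodicConfig y) t) (periodPoints n) x ↔
      IsMaxOn (fun y => ⨅ t : UnitAddCircle, thetaSum (1 / α) y t) (torusPoints n)
        fun j => (x j : UnitAddCircle) := by
  have hpos : 0 < (1 / α) ^ (1 / 2 : ℝ) := Real.rpow_pos_of_pos (by positivity) _
  constructor
  · intro h y hy
    obtain ⟨y, hy', rfl⟩ := exists_periodPoints_eq hy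
    have h1 : ⨅ t : ℝ, gaussianPotential α (periodicConfig y) t ≤
      ⨅ t : ℝ, gaussianPotential α (periodicConfig x) t := h hy'
    rw [iInf_gaussianPotential hα hy', iInf_gaussianPotential hα hx] at h1
    exact le_of_mul_le_mul_left h1 hpos
  · intro h y hy
    change ⨅ t : ℝ, gaussianPotential α (periodicConfig y) t ≤
      ⨅ t : ℝ, gaussianPotential α (periodicConfig x) t
    rw [iInf_gaussianPotential hα hy, iInf_gaussianPotential hα hx]
    exact mul_le_mul_of_nonneg_left (h (injective_coe_comp hy)) hpos.le

end LineTorus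

theorem mainTheorem1 (α : ℝ) (hα : 0 < α) :
    ∃ N : ℕ, ∀ n : ℕ, N ≤ n →
      -- on the line: the minima are attained, and equispaced points are the maximizers
      ((∀ x ∈ periodPoints n,
          IsLeast (Set.range (gaussianPotential α (periodicConfig x)))
            (⨅ t : ℝ, gaussianPotential α (periodicConfig x) t)) ∧
        (∀ x ∈ periodPoints n,
          (IsMaxOn (fun y => ⨅ t : ℝ, gaussianPotential α (periodicConfig y) t) (periodPoints n) x ↔
            IsEquispacedLine n (periodicConfig x)))) ∧
      -- on the torus: likewise
      ((∀ x ∈ torusPoints n,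
          IsLeast (Set.range (thetaSum α x)) (⨅ t : UnitAddCircle, thetaSum α x t)) ∧
        (∀ x ∈ torusPoints n,
          (IsMaxOn (fun y => ⨅ t : UnitAddCircle, thetaSum α y t) (torusPoints n) x ↔
            IsEquispacedTorus x))) := by
  have hα' : 0 < 1 / α := by positivity
  obtain ⟨N₁, h₁, hN₁⟩ := exists_forall_pow_mul_exp_lt hα
  obtain ⟨N₂, h₂, hN₂⟩ := exists_forall_pow_mul_exp_lt hα'
  -- The torus statement is needed for `α` itself and, through Poisson summation, for `1 / α`.
  refine ⟨max N₁ N₂, fun n hn => ?_⟩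
  have hn₁ := (le_max_left _ _).trans hn
  have hn₂ := (le_max_right _ _).trans hn
  have hn0 : 0 < n := h₁.trans_le hn₁
  refine ⟨⟨fun x hx => isLeast_range_gaussianPotential hα hx, fun x hx => ?_⟩,
    fun x _ => isLeast_range_thetaSum hα x,
    fun x hx => isMaxOn_iInf_thetaSum_iff hα hn0 (hN₁ n hn₁) hx⟩
  rw [isMaxOn_iInf_gaussianPotential_iff hα hx, isEquispacedLine_iff hn0]
  exact isMaxOn_iInf_thetaSum_iff hα' hn0 (hN₂ n hn₂) (injective_coe_comp hx)
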